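/- For $\mathrm{Im}\,\tau>0$, $\mathrm{Im}\,\sigma>0$ put $q=e^{2\pi i\tau}$, $r=e^{2\pi i\sigma}$, $x=e^{2\pi i z}$ and let \[ \theta_0(z,\tau)=\prod_{j=0}^\infty(1-xq^{j})(1-x^{-1}q^{j+1}),\qquad \Gamma(z,\tau,\sigma)=\prod_{j,k=0}^\infty\frac{1-x^{-1}q^{j+1}r^{k+1}}{1-xq^{j}r^{k}} \] be the theta function and the elliptic gamma function, and let \[ Q(z;\tau,\sigma)=\frac{z^3}{3\tau\sigma}-\frac{\tau+\sigma-1}{2\tau\sigma}z^2+\frac{\tau^2+\sigma^2+3\tau\sigma-3\tau-3\sigma+1}{6\tau\sigma}z+\frac1{12}(\tau+\sigma-1)(\tau^{-1}+\sigma^{-1}-1). \] For $\mathrm{Im}\,t<0$ let \[ \psi(t)=\exp\left(t\ln(1-e^{-2\pi i t})-\frac1{2\pi i}\mathrm{Li}_2(e^{-2\pi i t})\right),\qquad \mathrm{Li}_2(x)=\sum_{j=1}^\infty\frac{x^j}{j^2}, \] where $\ln(1-x)=-\sum_{j\ge1}x^j/j$ for $|x|<1$. Then $\psi$ has a unique meromorphic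 continuation to $\mathbb C$, again denoted by $\psi$. For all $\tau\in\mathbb C$ with $\mathrm{Im}\,\tau>0$ and all $z\in\mathbb C\setminus(\mathbb Z+\tau\mathbb Z)$, the infinite product below converges unconditionally, and \[ \Gamma(z,\tau,\tau)=\frac{e^{-\pi i Q(z;\tau,\tau)}}{\theta_0\left(\frac z\tau,-\frac1\tau\right)}\prod_{k=0}^\infty\frac{\psi\left(\frac{k+1+z}\tau\right)}{\psi\left(\frac{k-z}\tau\right)}. \] -/

import Mathlib

noncomputable section

/-- The product `(x; q) = ∏_{j ≥ 0} (1 - x q ^ j)`, for `|q| < 1`. -/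
def qProd (x q : ℂ) : ℂ :=
  ∏' j : ℕ, (1 - x * q ^ j)

/-- The double product `(x; q, r) = ∏_{j, k ≥ 0} (1 - x q ^ j r ^ k)`, for `|q|, |r| < 1`. -/
def qrProd (x q r : ℂ) : ℂ :=
  ∏' p : ℕ × ℕ, (1 - x * q ^ p.1 * r ^ p.2)

/-- The exponential `e(z) = e ^ (2 π i z)`. -/
def cexpTwoPiI (z : ℂ) : ℂ :=
  Complex.exp (2 * (Real.pi : ℂ) * Complex.I * z)

/-- The theta function `θ₀(z, τ) = (x; q) (q / x; q)`, with `x = e(z)`, `q = e(τ)`,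
for `Im τ > 0`. -/
def thetaZero (z τ : ℂ) : ℂ :=
  qProd (cexpTwoPiI z) (cexpTwoPiI τ) * qProd (cexpTwoPiI τ / cexpTwoPiI z) (cexpTwoPiI τ)

/-- The elliptic gamma function `Γ(z, τ, σ) = (q r / x; q, r) / (x; q, r)`, with `x = e(z)`,
`q = e(τ)`, `r = e(σ)`, for `Im τ > 0` and `Im σ > 0`. -/
def ellipticGamma (z τ σ : ℂ) : ℂ :=
  qrProd (cexpTwoPiI τ * cexpTwoPiI σ / cexpTwoPiI z) (cexpTwoPiI τ) (cexpTwoPiI σ) /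
    qrProd (cexpTwoPiI z) (cexpTwoPiI τ) (cexpTwoPiI σ)

/-- The function `Q(z; τ, σ)`, a cubic polynomial in `z`. -/
def cubicQ (z τ σ : ℂ) : ℂ :=
  z ^ 3 / (3 * τ * σ) - (τ + σ - 1) / (2 * τ * σ) * z ^ 2
    + (τ ^ 2 + σ ^ 2 + 3 * τ * σ - 3 * τ - 3 * σ + 1) / (6 * τ * σ) * z
    + 1 / 12 * (τ + σ - 1) * (τ⁻¹ + σ⁻¹ - 1)

/-- The dilogarithm `Li₂(x) = ∑_{j ≥ 1} x ^ j / j ^ 2`, for `|x| ≤ 1`. -/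
def dilog (x : ℂ) : ℂ :=
  ∑' j : ℕ, x ^ (j + 1) / ((j : ℂ) + 1) ^ 2

/-- The expression `exp (t ln (1 - e(-t)) - Li₂(e(-t)) / (2 π i))`, for `Im t < 0`. There
`|e(-t)| < 1`, so that the principal branch of the logarithm is `ln (1 - x) = -∑ x ^ j / j`. -/
def psiLower (t : ℂ) : ℂ :=
  Complex.exp (t * Complex.log (1 - cexpTwoPiI (-t))
    - 1 / (2 * (Real.pi : ℂ) * Complex.I) * dilog (cexpTwoPiI (-t)))

/-- `ψ` is a meromorphic continuation to `ℂ` of `psiLower` on the lower half plane. The normal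
form only says that `ψ` takes its limit as value wherever it has no pole (and the value `0`
at its poles), so that the values of `ψ` are those of the meromorphic function. -/
def IsPsiContinuation (ψ : ℂ → ℂ) : Prop :=
  MeromorphicNFOn ψ Set.univ ∧ Set.EqOn ψ psiLower {t : ℂ | t.im < 0}

end

/-!
Normalised at `z = 0`, the function `ψ` is the Weierstrass product with zeros of order `n` at `n`
and poles of order `n` at `-n`, corrected by a Gaussian; comparing logarithmic derivatives with the
partial fractions of the cotangent identifies it with the dilogarithm expression in the lower half
plane, whence `ψ(t + 1) = ψ(t) (1 - e(-t))` and `ψ(t) ψ(-t) = exp (-π i (t² - 1/6))`.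

The quotient `T` of the two sides of the modular transformation of `θ₀` is elliptic, and by the two
functional equations of `ψ` the quotient `R` of the two sides of the product formula at `z + τ`
satisfies `R(z + 1) = R(z)` and `R(z + τ) = T(z) R(z)`. Both are holomorphic except at the nonzero
lattice points, and a fundamental parallelogram centred at `0` avoids these. Hence `T` is a constant
`c`, and the product of its values at the three half periods gives `c³ = 1`. As `|c| = 1`, the
function `|R|` is doubly periodic, so that `R` is constant by the maximum principle, and `R(0) = 1`.
-/

noncomputable section

open Complex Filter Topology Set

/-- Normal convergence of the product `∏ᵢ fᵢ` of holomorphic functions on the open set `U`: on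
every compact subset of `U` the `fᵢ - 1` are eventually dominated by a summable family of
constants. -/
structure NormalProductOn {ι : Type*} (f : ι → ℂ → ℂ) (U : Set ℂ) : Prop where
  isOpen : IsOpen U
  differentiableOn : ∀ i, DifferentiableOn ℂ (f i) U
  bound : ∀ K ⊆ U, IsCompact K →
    ∃ u : ι → ℝ, Summable u ∧ ∀ᶠ i in cofinite, ∀ z ∈ K, ‖f i z - 1‖ ≤ u i

namespace NormalProductOn

variable {ι : Type*} {f : ι → ℂ → ℂ} {U : Set ℂ} {z : ℂ}

lemma hasProdLocallyUniformlyOn (hf : NormalProductOn f U) :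
    HasProdLocallyUniformlyOn f (fun z => ∏' i, f i z) U := by
  refine hasProdLocallyUniformlyOn_of_forall_compact hf.isOpen fun K hKU hK => ?_
  obtain ⟨u, hu, hbound⟩ := hf.bound K hKU hK
  simpa using hu.hasProdUniformlyOn_one_add hK hbound
    fun i => ((hf.differentiableOn i).continuousOn.mono hKU).sub continuousOn_const

lemma differentiableOn_tprod (hf : NormalProductOn f U) :
    DifferentiableOn ℂ (fun z => ∏' i, f i z) U :=
  (hasProdLocallyUniformlyOn_iff_tendstoLocallyUniformlyOn.1
    hf.hasProdLocallyUniformlyOn).differentiableOn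
    (Eventually.of_forall fun _ => .fun_finsetProd fun i _ => hf.differentiableOn i) hf.isOpen

lemma summable_norm_sub_one (hf : NormalProductOn f U) (hz : z ∈ U) :
    Summable fun i => ‖f i z - 1‖ := by
  obtain ⟨u, hu, hbound⟩ := hf.bound {z} (singleton_subset_iff.2 hz) isCompact_singleton
  refine hu.of_norm_bounded_eventually (hbound.mono fun i hi => ?_)
  simpa using hi z rfl

lemma multipliable (hf : NormalProductOn f U) (hz : z ∈ U) : Multipliable fun i => f i z := by
  simpa using multipliable_one_add_of_summable (hf.summable_norm_sub_one hz)

lemma tprod_ne_zero (hf : NormalProductOn f U) (hz : z ∈ U) (h0 : ∀ i, f i z ≠ 0) :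
    ∏' i, f i z ≠ 0 := by
  simpa using tprod_one_add_ne_zero_of_summable (f := fun i => f i z - 1) (by simpa using h0)
    (hf.summable_norm_sub_one hz)

end NormalProductOn

section Liouville

lemma exists_eq_mul_add_mul (L : PeriodPair) (z : ℂ) : ∃ a b : ℝ, z = a * L.ω₁ + b * L.ω₂ :=
  ⟨L.basis.repr z 0, L.basis.repr z 1, by simpa using (L.basis.sum_repr z).symm⟩

lemma neg_mem_compl_lattice_sdiff {L : PeriodPair} {z : ℂ}
    (hz : z ∈ (L.lattice \ {0} : Set ℂ)ᶜ) :
    -z ∈ (L.lattice \ {0} : Set ℂ)ᶜ := by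
  simpa using hz

lemma mem_compl_lattice_sdiff {L : PeriodPair} {z : ℂ} (hz : z ∉ L.lattice) :
    z ∈ (L.lattice \ {0} : Set ℂ)ᶜ := fun h => hz h.1

/-- The closed period parallelogram of the pair `L` centred at the origin. It contains a
representative of every class modulo the lattice, but no nonzero lattice point. -/
def centredParallelogram (L : PeriodPair) : Set ℂ :=
  (fun p : ℝ × ℝ => (p.1 * L.ω₁ + p.2 * L.ω₂ : ℂ)) '' (Icc (-1 / 2) (1 / 2) ×ˢ Icc (-1 / 2) (1 / 2))

lemma isCompact_centredParallelogram (L : PeriodPair) : IsCompact (centredParallelogram L) :=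
  (isCompact_Icc.prod isCompact_Icc).image (by fun_prop)

lemma zero_mem_centredParallelogram (L : PeriodPair) : 0 ∈ centredParallelogram L :=
  ⟨(0, 0), by norm_num, by simp⟩

lemma exists_mem_centredParallelogram_sub_mem_lattice (L : PeriodPair) (z : ℂ) :
    ∃ w ∈ centredParallelogram L, z - w ∈ L.lattice := by
  obtain ⟨a, b, rfl⟩ := exists_eq_mul_add_mul L z
  have h_round (x : ℝ) : x - round x ∈ Icc (-1 / 2 : ℝ) (1 / 2) := by
    simpa only [mem_Icc, neg_div] using abs_le.1 (abs_sub_round x)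
  refine ⟨_, ⟨(a - round a, b - round b), ⟨h_round a, h_round b⟩, rfl⟩,
    PeriodPair.mem_lattice.2 ⟨round a, round b, ?_⟩⟩
  push_cast
  ring

lemma centredParallelogram_subset (L : PeriodPair) :
    centredParallelogram L ⊆ (L.lattice \ {0} : Set ℂ)ᶜ := by
  rintro _ ⟨⟨a, b⟩, ⟨ha, hb⟩, rfl⟩ ⟨hmem, h0⟩
  obtain ⟨m, n, h⟩ := PeriodPair.mem_lattice.1 hmem
  obtain ⟨hma, hnb⟩ : (m : ℝ) = a ∧ (n : ℝ) = b := by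
    have := LinearIndependent.pair_iff.1 L.indep (m - a) (n - b) (by
      push_cast [Complex.real_smul]
      linear_combination h)
    simpa only [sub_eq_zero] using this
  have h_int {k : ℤ} {x : ℝ} (hk : (k : ℝ) = x) (hx : x ∈ Icc (-1 / 2 : ℝ) (1 / 2)) : k = 0 := by
    obtain ⟨h1, h2⟩ := hx
    have h3 : (-1 : ℝ) < k := by linarith
    have h4 : (k : ℝ) < 1 := by linarith
    norm_cast at h3 h4
    lia
  have hm := h_int hma ha
  have hn := h_int hnb hb
  exact h0 (by simp [← hma, ← hnb, hm, hn])

variable {F : Type*} [NormedAddCommGroup F]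

lemma norm_add_eq_norm_of_mem_lattice {L : PeriodPair} {f : ℂ → F}
    (h1 : ∀ z ∉ L.lattice, ‖f (z + L.ω₁)‖ = ‖f z‖) (h2 : ∀ z ∉ L.lattice, ‖f (z + L.ω₂)‖ = ‖f z‖)
    {l : ℂ} (hl : l ∈ L.lattice) : ∀ z ∉ L.lattice, ‖f (z + l)‖ = ‖f z‖ := by
  have h_closure (x : ℂ) : x ∈ L.lattice ↔ x ∈ AddSubgroup.closure {L.ω₁, L.ω₂} := by
    rw [← Submodule.span_int_eq_addSubgroupClosure]
    rfl
  rw [h_closure] at hl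
  induction hl using AddSubgroup.closure_induction with
  | mem x hx =>
    rcases hx with rfl | rfl
    exacts [h1, h2]
  | zero => simp
  | add x y hx _ ihx ihy =>
    intro z hz
    rw [← add_assoc, ihy _ (by rwa [add_mem_cancel_right ((h_closure x).2 hx)]), ihx z hz]
  | neg x hx ih =>
    intro z hz
    rw [← ih _ (by rwa [add_mem_cancel_right (neg_mem ((h_closure x).2 hx))]), neg_add_cancel_right]

/-- A version of Liouville's theorem in which only the norm of `f` is doubly periodic. -/
lemma eqOn_const_of_norm_periodic [NormedSpace ℂ F] [StrictConvexSpace ℝ F] {L : PeriodPair}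
    {f : ℂ → F} (hf : DifferentiableOn ℂ f (L.lattice \ {0} : Set ℂ)ᶜ)
    (h1 : ∀ z ∉ L.lattice, ‖f (z + L.ω₁)‖ = ‖f z‖)
    (h2 : ∀ z ∉ L.lattice, ‖f (z + L.ω₂)‖ = ‖f z‖) :
    EqOn f (fun _ => f 0) (L.lattice \ {0} : Set ℂ)ᶜ := by
  set U := (L.lattice \ {0} : Set ℂ)ᶜ
  have h_conn : IsPreconnected U :=
    (Set.Countable.isConnected_compl_of_one_lt_rank (by simp)
      (.mono sdiff_le (countable_of_Lindelof_of_discrete (X := L.lattice)))).isPreconnected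
  have hSU := centredParallelogram_subset L
  obtain ⟨c, hcS, hc⟩ := (isCompact_centredParallelogram L).exists_isMaxOn
    ⟨0, zero_mem_centredParallelogram L⟩ (hf.continuousOn.mono hSU).norm
  have h_max : IsMaxOn (norm ∘ f) U c := by
    intro z hz
    rcases eq_or_ne z 0 with rfl | hz0
    · exact hc (zero_mem_centredParallelogram L)
    obtain ⟨w, hwS, hl⟩ := exists_mem_centredParallelogram_sub_mem_lattice L z
    have hw : w ∉ L.lattice := fun hw => hz ⟨by simpa using add_mem hl hw, hz0⟩
    have h_norm := norm_add_eq_norm_of_mem_lattice h1 h2 hl w hw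
    rw [add_sub_cancel] at h_norm
    exact h_norm.trans_le (hc hwS)
  have h_const := Complex.eqOn_of_isPreconnected_of_isMaxOn_norm h_conn
    L.isOpen_compl_lattice_sdiff hf (hSU hcS) h_max
  exact fun z hz => (h_const hz).trans (h_const (hSU (zero_mem_centredParallelogram L))).symm

end Liouville

section QProducts

lemma normalProductOn_one_sub_mul {ι : Type*} {c : ι → ℂ} (hc : Summable fun i => ‖c i‖) :
    NormalProductOn (fun i x => 1 - x * c i) univ where
  isOpen := isOpen_univ
  differentiableOn i := by fun_prop
  bound K _ hK := by
    obtain ⟨R, hR⟩ := hK.isBounded.exists_norm_le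
    refine ⟨fun i => R * ‖c i‖, hc.mul_left R, .of_forall fun i x hx => ?_⟩
    rw [sub_sub_cancel_left, norm_neg, norm_mul]
    exact mul_le_mul_of_nonneg_right (hR x hx) (norm_nonneg _)

variable {q r x : ℂ}

lemma normalProductOn_qProd (hq : ‖q‖ < 1) :
    NormalProductOn (fun (j : ℕ) x => 1 - x * q ^ j) univ :=
  normalProductOn_one_sub_mul (summable_geometric_of_norm_lt_one hq).norm

lemma normalProductOn_qrProd (hq : ‖q‖ < 1) (hr : ‖r‖ < 1) :
    NormalProductOn (fun (p : ℕ × ℕ) x => 1 - x * q ^ p.1 * r ^ p.2) univ := by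
  simpa only [mul_assoc] using normalProductOn_one_sub_mul
    ((summable_geometric_of_norm_lt_one hq).norm.mul_norm
      (summable_geometric_of_norm_lt_one hr).norm)

lemma multipliable_qProd (hq : ‖q‖ < 1) (x : ℂ) : Multipliable fun j : ℕ => 1 - x * q ^ j :=
  (normalProductOn_qProd hq).multipliable (mem_univ x)

lemma differentiable_qProd (hq : ‖q‖ < 1) : Differentiable ℂ fun x => qProd x q :=
  differentiableOn_univ.1 (normalProductOn_qProd hq).differentiableOn_tprod

lemma differentiable_qrProd (hq : ‖q‖ < 1) (hr : ‖r‖ < 1) :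
    Differentiable ℂ fun x => qrProd x q r :=
  differentiableOn_univ.1 (normalProductOn_qrProd hq hr).differentiableOn_tprod

lemma qProd_ne_zero (hq : ‖q‖ < 1) (hx : ∀ j : ℕ, x * q ^ j ≠ 1) : qProd x q ≠ 0 :=
  (normalProductOn_qProd hq).tprod_ne_zero (mem_univ x) fun j => sub_ne_zero.2 (hx j).symm

lemma qrProd_ne_zero (hq : ‖q‖ < 1) (hr : ‖r‖ < 1) (hx : ∀ j k : ℕ, x * q ^ j * r ^ k ≠ 1) :
    qrProd x q r ≠ 0 :=
  (normalProductOn_qrProd hq hr).tprod_ne_zero (mem_univ x)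
    fun p => sub_ne_zero.2 (hx p.1 p.2).symm

lemma qProd_ne_zero_of_norm_lt_one (hq : ‖q‖ < 1) (hx : ‖x‖ < 1) : qProd x q ≠ 0 := by
  refine qProd_ne_zero hq fun j h => ?_
  have h_norm := congrArg norm h
  rw [norm_mul, norm_pow, norm_one] at h_norm
  exact (mul_lt_one_of_nonneg_of_lt_one_left (norm_nonneg x) hx
    (pow_le_one₀ (norm_nonneg q) hq.le)).ne h_norm

lemma qProd_eq_one_sub_mul (hq : ‖q‖ < 1) (x : ℂ) : qProd x q = (1 - x) * qProd (x * q) q := by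
  have h_shift (j : ℕ) : 1 - x * q ^ (j + 1) = 1 - x * q * q ^ j := by ring
  rw [qProd, tprod_eq_zero_mul' (by simpa only [h_shift] using multipliable_qProd hq (x * q))]
  simp only [h_shift, pow_zero, mul_one, qProd]

lemma hasProd_qProd_mul_pow (hq : ‖q‖ < 1) (hr : ‖r‖ < 1) (x : ℂ) :
    HasProd (fun j : ℕ => qProd (x * q ^ j) r) (qrProd x q r) :=
  ((normalProductOn_qrProd hq hr).multipliable (mem_univ x)).hasProd.prod_fiberwise
    fun j => (multipliable_qProd hr (x * q ^ j)).hasProd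

lemma qrProd_eq_qProd_mul (hq : ‖q‖ < 1) (hr : ‖r‖ < 1) (x : ℂ) :
    qrProd x q r = qProd x r * qrProd (x * q) q r := by
  have h_shift (j : ℕ) : x * q ^ (j + 1) = x * q * q ^ j := by ring
  have h_tail := hasProd_qProd_mul_pow hq hr (x * q)
  rw [← (hasProd_qProd_mul_pow hq hr x).tprod_eq,
    tprod_eq_zero_mul' (by simpa only [h_shift] using h_tail.multipliable)]
  simp only [h_shift, h_tail.tprod_eq, pow_zero, mul_one]

lemma qProd_mul_qProd_neg (hq : ‖q‖ < 1) (x : ℂ) :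
    qProd x q * qProd (-x) q = qProd (x ^ 2) (q ^ 2) := by
  rw [qProd, qProd, ← (multipliable_qProd hq x).tprod_mul (multipliable_qProd hq (-x))]
  exact tprod_congr fun j => by ring

lemma norm_sq_lt_one (hq : ‖q‖ < 1) : ‖q ^ 2‖ < 1 := by
  rw [norm_pow]
  exact pow_lt_one₀ (norm_nonneg q) hq two_ne_zero

lemma qProd_sq_mul_qProd_mul_sq (hq : ‖q‖ < 1) (x : ℂ) :
    qProd x (q ^ 2) * qProd (x * q) (q ^ 2) = qProd x q := by
  have h_even (j : ℕ) : 1 - x * q ^ (2 * j) = 1 - x * (q ^ 2) ^ j := by ring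
  have h_odd (j : ℕ) : 1 - x * q ^ (2 * j + 1) = 1 - x * q * (q ^ 2) ^ j := by ring
  have hq2 := norm_sq_lt_one hq
  have h := tprod_even_mul_odd (f := fun j : ℕ => 1 - x * q ^ j)
    (by simpa only [h_even] using multipliable_qProd hq2 x)
    (by simpa only [h_odd] using multipliable_qProd hq2 (x * q))
  simpa only [qProd, h_even, h_odd] using h

/-- Euler's theorem on partitions into distinct parts and into odd parts. -/
lemma qProd_neg_mul_qProd_sq (hq : ‖q‖ < 1) : qProd (-q) q * qProd q (q ^ 2) = 1 := by
  have h1 := qProd_mul_qProd_neg hq q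
  have h2 := qProd_sq_mul_qProd_mul_sq hq q
  rw [← sq, ← h1] at h2
  refine mul_left_cancel₀ (qProd_ne_zero_of_norm_lt_one hq hq) ?_
  linear_combination h2

end QProducts

section CexpTwoPiI

lemma norm_cexpTwoPiI (z : ℂ) : ‖cexpTwoPiI z‖ = Real.exp (-(2 * Real.pi * z.im)) := by
  simp [cexpTwoPiI, norm_exp]

lemma cexpTwoPiI_ne_zero (z : ℂ) : cexpTwoPiI z ≠ 0 := exp_ne_zero _

lemma cexpTwoPiI_add (z w : ℂ) : cexpTwoPiI (z + w) = cexpTwoPiI z * cexpTwoPiI w := by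
  simp [cexpTwoPiI, mul_add, exp_add]

lemma cexpTwoPiI_sub (z w : ℂ) : cexpTwoPiI (z - w) = cexpTwoPiI z / cexpTwoPiI w := by
  simp [cexpTwoPiI, mul_sub, exp_sub]

lemma cexpTwoPiI_neg (z : ℂ) : cexpTwoPiI (-z) = (cexpTwoPiI z)⁻¹ := by
  simp [cexpTwoPiI, exp_neg]

lemma cexpTwoPiI_natCast_mul (n : ℕ) (z : ℂ) : cexpTwoPiI (n * z) = cexpTwoPiI z ^ n := by
  rw [cexpTwoPiI, cexpTwoPiI, ← exp_nat_mul]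
  ring_nf

lemma cexpTwoPiI_eq_one_iff {z : ℂ} : cexpTwoPiI z = 1 ↔ ∃ n : ℤ, z = n := by
  rw [cexpTwoPiI, exp_eq_one_iff]
  refine exists_congr fun n => ?_
  rw [mul_comm, mul_left_inj' two_pi_I_ne_zero]

lemma cexpTwoPiI_one : cexpTwoPiI 1 = 1 := cexpTwoPiI_eq_one_iff.2 ⟨1, by simp⟩

lemma cexpTwoPiI_zero : cexpTwoPiI 0 = 1 := by simp [cexpTwoPiI]

lemma cexpTwoPiI_half : cexpTwoPiI (1 / 2) = -1 := by
  rw [cexpTwoPiI, ← exp_pi_mul_I]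
  ring_nf

lemma norm_cexpTwoPiI_lt_one_iff {z : ℂ} : ‖cexpTwoPiI z‖ < 1 ↔ 0 < z.im := by
  rw [norm_cexpTwoPiI, Real.exp_lt_one_iff, neg_lt_zero, mul_pos_iff_of_pos_left Real.two_pi_pos]

lemma norm_cexpTwoPiI_lt_one {z : ℂ} (hz : 0 < z.im) : ‖cexpTwoPiI z‖ < 1 :=
  norm_cexpTwoPiI_lt_one_iff.2 hz

lemma norm_cexpTwoPiI_le (z : ℂ) : ‖cexpTwoPiI z‖ ≤ Real.exp (2 * Real.pi * ‖z‖) := by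
  rw [norm_cexpTwoPiI, Real.exp_le_exp, ← mul_neg]
  exact mul_le_mul_of_nonneg_left ((neg_le_abs _).trans (abs_im_le_norm z)) Real.two_pi_pos.le

lemma hasDerivAt_cexpTwoPiI (z : ℂ) :
    HasDerivAt cexpTwoPiI (cexpTwoPiI z * (2 * Real.pi * I)) z := by
  simpa only [mul_one] using! ((hasDerivAt_id z).const_mul (2 * (Real.pi : ℂ) * I)).cexp

lemma differentiable_cexpTwoPiI : Differentiable ℂ cexpTwoPiI :=
  fun z => (hasDerivAt_cexpTwoPiI z).differentiableAt

end CexpTwoPiI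

section ModularPair

lemma ne_zero_of_im_pos {τ : ℂ} (hτ : 0 < τ.im) : τ ≠ 0 := by
  rintro rfl
  exact hτ.false

lemma im_neg_one_div_pos {τ : ℂ} (hτ : 0 < τ.im) : 0 < (-1 / τ).im := by
  rw [neg_div, one_div, neg_im, inv_im, neg_div, neg_neg]
  exact div_pos hτ (normSq_pos.2 (ne_zero_of_im_pos hτ))

/-- The pair of periods `1, τ` for `τ` in the upper half plane. -/
def modularPair {τ : ℂ} (hτ : 0 < τ.im) : PeriodPair where
  ω₁ := 1
  ω₂ := τ
  indep := LinearIndependent.pair_iff.2 fun a b h => by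
    have hb : b = 0 := by simpa [hτ.ne'] using congrArg im h
    exact ⟨by simpa [hb] using congrArg re h, hb⟩

variable {τ z : ℂ} (hτ : 0 < τ.im)

lemma mem_lattice_modularPair :
    z ∈ (modularPair hτ).lattice ↔ ∃ m n : ℤ, z = m + n * τ := by
  simp [PeriodPair.mem_lattice, modularPair, eq_comm]

lemma one_mem_lattice : 1 ∈ (modularPair hτ).lattice := (modularPair hτ).ω₁_mem_lattice

lemma self_mem_lattice : τ ∈ (modularPair hτ).lattice := (modularPair hτ).ω₂_mem_lattice

lemma div_notMem_lattice (hz : z ∉ (modularPair hτ).lattice) :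
    z / τ ∉ (modularPair (im_neg_one_div_pos hτ)).lattice := by
  have h0 := ne_zero_of_im_pos hτ
  rw [mem_lattice_modularPair] at hz ⊢
  rintro ⟨m, n, h⟩
  refine hz ⟨-n, m, ?_⟩
  field_simp at h
  push_cast
  linear_combination h

end ModularPair

section Theta

variable {τ z : ℂ}

lemma thetaZero_add_one (z τ : ℂ) : thetaZero (z + 1) τ = thetaZero z τ := by
  simp only [thetaZero, cexpTwoPiI_add, cexpTwoPiI_one, mul_one]

lemma thetaZero_add_self (hτ : 0 < τ.im) (z : ℂ) :
    thetaZero (z + τ) τ = -cexpTwoPiI (-z) * thetaZero z τ := by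
  have hx := cexpTwoPiI_ne_zero z
  have hq := norm_cexpTwoPiI_lt_one hτ
  have h_left := qProd_eq_one_sub_mul hq (cexpTwoPiI z)
  have h_right := qProd_eq_one_sub_mul hq (cexpTwoPiI z)⁻¹
  rw [inv_mul_eq_div] at h_right
  rw [thetaZero, thetaZero, cexpTwoPiI_add, cexpTwoPiI_neg,
    div_mul_cancel_right₀ (cexpTwoPiI_ne_zero τ), h_left, h_right]
  field_simp
  ring

lemma qProd_cexpTwoPiI_mul_qProd_cexpTwoPiI_neg (hτ : 0 < τ.im) (z : ℂ) :
    qProd (cexpTwoPiI z) (cexpTwoPiI τ) * qProd (cexpTwoPiI (-z)) (cexpTwoPiI τ) =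
      (1 - cexpTwoPiI (-z)) * thetaZero z τ := by
  rw [qProd_eq_one_sub_mul (norm_cexpTwoPiI_lt_one hτ) (cexpTwoPiI (-z)), thetaZero,
    div_eq_inv_mul, ← cexpTwoPiI_neg, mul_left_comm]

lemma qProd_cexpTwoPiI_ne_zero (hτ : 0 < τ.im) (hz : z ∉ (modularPair hτ).lattice) :
    qProd (cexpTwoPiI z) (cexpTwoPiI τ) ≠ 0 := by
  refine qProd_ne_zero (norm_cexpTwoPiI_lt_one hτ) fun j h => ?_
  rw [← cexpTwoPiI_natCast_mul, ← cexpTwoPiI_add, cexpTwoPiI_eq_one_iff] at h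
  obtain ⟨n, hn⟩ := h
  refine hz ((mem_lattice_modularPair hτ).2 ⟨n, -j, ?_⟩)
  push_cast
  linear_combination hn

lemma thetaZero_ne_zero (hτ : 0 < τ.im) (hz : z ∉ (modularPair hτ).lattice) :
    thetaZero z τ ≠ 0 := by
  rw [thetaZero, ← cexpTwoPiI_sub]
  exact mul_ne_zero (qProd_cexpTwoPiI_ne_zero hτ hz) (qProd_cexpTwoPiI_ne_zero hτ
    (by rwa [sub_mem_comm_iff, sub_eq_add_neg, add_mem_cancel_right
      (neg_mem (self_mem_lattice hτ))]))

lemma differentiable_thetaZero (hτ : 0 < τ.im) : Differentiable ℂ fun z => thetaZero z τ := by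
  have hq := differentiable_qProd (norm_cexpTwoPiI_lt_one hτ)
  simp only [thetaZero, ← cexpTwoPiI_sub]
  exact (hq.comp differentiable_cexpTwoPiI).mul
    (hq.comp (differentiable_cexpTwoPiI.comp (by fun_prop)))

lemma thetaZero_zero (hτ : 0 < τ.im) : thetaZero 0 τ = 0 := by
  rw [thetaZero, cexpTwoPiI_zero, qProd_eq_one_sub_mul (norm_cexpTwoPiI_lt_one hτ)]
  simp

lemma hasDerivAt_thetaZero_zero (hτ : 0 < τ.im) : HasDerivAt (fun z => thetaZero z τ)
    (-(2 * Real.pi * I) * qProd (cexpTwoPiI τ) (cexpTwoPiI τ) ^ 2) 0 := by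
  have hq := norm_cexpTwoPiI_lt_one hτ
  set g : ℂ → ℂ := fun z => qProd (cexpTwoPiI (z + τ)) (cexpTwoPiI τ) *
    qProd (cexpTwoPiI (τ - z)) (cexpTwoPiI τ)
  have hg : DifferentiableAt ℂ g 0 := by
    have h_diff := differentiable_qProd hq
    exact ((h_diff.comp (differentiable_cexpTwoPiI.comp (by fun_prop))).mul
      (h_diff.comp (differentiable_cexpTwoPiI.comp (by fun_prop)))) 0
  have h_eq : (fun z => thetaZero z τ) = fun z => (1 - cexpTwoPiI z) * g z := by
    funext z
    rw [thetaZero, qProd_eq_one_sub_mul hq, ← cexpTwoPiI_add, ← cexpTwoPiI_sub, mul_assoc]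
  rw [h_eq]
  convert! ((hasDerivAt_cexpTwoPiI 0).const_sub 1).mul hg.hasDerivAt using 1
  simp [g, cexpTwoPiI_zero]
  ring

lemma thetaZero_half_periods (hτ : 0 < τ.im) :
    thetaZero (1 / 2) τ * thetaZero (τ / 2) τ * thetaZero ((1 + τ) / 2) τ = 2 := by
  have hq := norm_cexpTwoPiI_lt_one hτ
  set p := cexpTwoPiI (τ / 2)
  have hp0 : p ≠ 0 := cexpTwoPiI_ne_zero _
  have hqp : cexpTwoPiI τ = p ^ 2 := by
    rw [← cexpTwoPiI_natCast_mul, Nat.cast_ofNat, mul_div_cancel₀ _ two_ne_zero]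
  rw [hqp] at hq
  have h_one : thetaZero (1 / 2) τ = 2 * qProd (-p ^ 2) (p ^ 2) ^ 2 := by
    rw [thetaZero, cexpTwoPiI_half, hqp, qProd_eq_one_sub_mul hq, neg_one_mul, div_neg, div_one]
    ring
  have h_tau : thetaZero (τ / 2) τ = qProd p (p ^ 2) ^ 2 := by
    rw [thetaZero, hqp, sq p, mul_div_cancel_right₀ p hp0, ← sq]
  have h_sum : thetaZero ((1 + τ) / 2) τ = qProd (-p) (p ^ 2) ^ 2 := by
    rw [thetaZero, add_div, cexpTwoPiI_add, cexpTwoPiI_half, hqp, neg_one_mul, div_neg, sq p,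
      mul_div_cancel_right₀ p hp0, ← sq]
  calc _ = 2 * (qProd (-p ^ 2) (p ^ 2) * (qProd p (p ^ 2) * qProd (-p) (p ^ 2))) ^ 2 := by
        rw [h_one, h_tau, h_sum]
        ring
    _ = 2 := by rw [qProd_mul_qProd_neg hq, qProd_neg_mul_qProd_sq hq, one_pow, mul_one]

lemma thetaZero_neg_half_periods (hτ : 0 < τ.im) :
    thetaZero (1 / 2) τ * thetaZero (-τ / 2) τ * thetaZero ((1 - τ) / 2) τ =
      -2 * cexpTwoPiI (-τ) := by
  have h_tau := thetaZero_add_self hτ (-τ / 2)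
  have h_sum := thetaZero_add_self hτ ((1 - τ) / 2)
  have h_half : cexpTwoPiI (τ / 2) ^ 2 = cexpTwoPiI τ := by
    rw [← cexpTwoPiI_natCast_mul, Nat.cast_ofNat, mul_div_cancel₀ _ two_ne_zero]
  rw [show -τ / 2 + τ = τ / 2 by ring, show -(-τ / 2) = τ / 2 by ring] at h_tau
  rw [show (1 - τ) / 2 + τ = (1 + τ) / 2 by ring, show -((1 - τ) / 2) = τ / 2 - 1 / 2 by ring,
    cexpTwoPiI_sub, cexpTwoPiI_half, div_neg, div_one, neg_neg] at h_sum
  have h := thetaZero_half_periods hτ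
  rw [h_tau, h_sum] at h
  rw [cexpTwoPiI_neg, ← div_eq_mul_inv, eq_div_iff (cexpTwoPiI_ne_zero τ), ← h_half]
  linear_combination -h

end Theta

section EllipticGamma

variable {τ σ z : ℂ}

lemma ellipticGamma_add_one (z τ σ : ℂ) : ellipticGamma (z + 1) τ σ = ellipticGamma z τ σ := by
  simp only [ellipticGamma, cexpTwoPiI_add, cexpTwoPiI_one, mul_one]

lemma ellipticGamma_add_self (hτ : 0 < τ.im) (hσ : 0 < σ.im) (hz : z ∉ (modularPair hσ).lattice) :
    ellipticGamma (z + τ) τ σ = thetaZero z σ * ellipticGamma z τ σ := by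
  have hq := norm_cexpTwoPiI_lt_one hτ
  have hr := norm_cexpTwoPiI_lt_one hσ
  have hq0 := cexpTwoPiI_ne_zero τ
  have h0 := qProd_cexpTwoPiI_ne_zero hσ hz
  have h_num := qrProd_eq_qProd_mul hq hr (cexpTwoPiI σ / cexpTwoPiI z)
  rw [div_mul_eq_mul_div, mul_comm (cexpTwoPiI σ)] at h_num
  rw [ellipticGamma, ellipticGamma, thetaZero, cexpTwoPiI_add, mul_comm (cexpTwoPiI z),
    mul_div_mul_left _ _ hq0, mul_comm (cexpTwoPiI τ) (cexpTwoPiI z), h_num,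
    qrProd_eq_qProd_mul hq hr (cexpTwoPiI z)]
  field_simp

end EllipticGamma

section PsiNum

/-- The `k`-th factor of the Weierstrass product for `psiNum`, with a zero of order `k + 1`
at `k + 1`. -/
def psiFactor (k : ℕ) (t : ℂ) : ℂ :=
  ((1 - t / (k + 1)) * exp (t / (k + 1) + (t / (k + 1)) ^ 2 / 2)) ^ (k + 1)

/-- The canonical product over the positive integers `n`, each taken with multiplicity `n`. -/
def psiNum (t : ℂ) : ℂ := ∏' k : ℕ, psiFactor k t

variable {k : ℕ} {t : ℂ}

lemma differentiable_psiFactor (k : ℕ) : Differentiable ℂ (psiFactor k) := by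
  unfold psiFactor; fun_prop

lemma psiFactor_ne_zero (ht : t ≠ k + 1) : psiFactor k t ≠ 0 := by
  have h : 1 - t / (k + 1) ≠ 0 := by
    rwa [sub_ne_zero, ne_comm, Ne, div_eq_one_iff_eq (Nat.cast_add_one_ne_zero k)]
  exact pow_ne_zero _ (mul_ne_zero h (exp_ne_zero _))

lemma norm_natCast_add_one (k : ℕ) : ‖(k : ℂ) + 1‖ = k + 1 := by
  exact_mod_cast Complex.norm_natCast (k + 1)

lemma psiFactor_eq_exp (ht : t ≠ k + 1) :
    psiFactor k t = exp ((k + 1) * (log (1 + -(t / (k + 1))) - logTaylor 3 (-(t / (k + 1))))) := by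
  have h : 1 + -(t / (k + 1)) ≠ 0 := by
    rwa [← sub_eq_add_neg, sub_ne_zero, ne_comm, Ne, div_eq_one_iff_eq (Nat.cast_add_one_ne_zero k)]
  have h_taylor : logTaylor 3 (-(t / (k + 1))) = -(t / (k + 1) + (t / (k + 1)) ^ 2 / 2) := by
    simp only [logTaylor_succ, logTaylor_zero, Pi.add_apply]
    push_cast
    ring
  rw [psiFactor, h_taylor, sub_neg_eq_add, ← Nat.cast_add_one, exp_nat_mul, Nat.cast_add_one,
    exp_add (log _), exp_log h, ← sub_eq_add_neg]

lemma norm_psiFactor_sub_one_le (hk : ‖t‖ ≤ (k + 1) / 2) (hk' : ‖t‖ ^ 3 ≤ (k + 1) ^ 2) :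
    ‖psiFactor k t - 1‖ ≤ 2 * ‖t‖ ^ 3 / ((k : ℝ) + 1) ^ 2 := by
  have hk0 : (0 : ℝ) < k + 1 := by positivity
  set u : ℂ := t / (k + 1) with hu
  have hu_norm : ‖u‖ = ‖t‖ / (k + 1) := by rw [hu, norm_div, norm_natCast_add_one]
  have hu_le : ‖u‖ ≤ 1 / 2 := by rw [hu_norm, div_le_iff₀ hk0]; linarith
  have hne : t ≠ k + 1 := by rintro rfl; rw [norm_natCast_add_one] at hk; linarith
  have h_inv : (1 - ‖u‖)⁻¹ ≤ 2 := by
    rw [inv_le_comm₀ (by linarith) (by norm_num)]; linarith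
  have h_exponent : ‖((k : ℂ) + 1) * (log (1 + -u) - logTaylor 3 (-u))‖
      ≤ ‖t‖ ^ 3 / ((k : ℝ) + 1) ^ 2 := by
    rw [norm_mul, norm_natCast_add_one]
    calc ((k : ℝ) + 1) * ‖log (1 + -u) - logTaylor 3 (-u)‖
        ≤ (k + 1) * (‖-u‖ ^ 3 * (1 - ‖-u‖)⁻¹ / ((2 : ℕ) + 1)) := by
          gcongr
          exact norm_log_sub_logTaylor_le 2 (by rw [norm_neg]; linarith)
      _ ≤ (k + 1) * (‖u‖ ^ 3 * 2 / 2) := by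
          rw [norm_neg]
          gcongr
          norm_num
      _ = ‖t‖ ^ 3 / ((k : ℝ) + 1) ^ 2 := by rw [hu_norm]; field_simp
  rw [psiFactor_eq_exp hne, mul_div_assoc]
  refine (norm_exp_sub_one_le (h_exponent.trans ?_)).trans (by gcongr)
  exact (div_le_one (by positivity)).2 hk'

lemma summable_const_div_succ_sq (c : ℝ) : Summable fun k : ℕ => c / ((k : ℝ) + 1) ^ 2 := by
  have h := (summable_nat_add_iff 1).2 ((Real.summable_nat_pow_inv.2 one_lt_two).mul_left c)
  simpa [div_eq_mul_inv] using h

lemma normalProductOn_psiFactor : NormalProductOn psiFactor univ where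
  isOpen := isOpen_univ
  differentiableOn k := (differentiable_psiFactor k).differentiableOn
  bound K _ hK := by
    obtain ⟨R, hR⟩ := hK.isBounded.exists_norm_le
    refine ⟨_, summable_const_div_succ_sq (2 * R ^ 3), ?_⟩
    have h_tendsto : Tendsto (fun k : ℕ => (k : ℝ)) cofinite atTop := by
      rw [Nat.cofinite_eq_atTop]; exact tendsto_natCast_atTop_atTop
    filter_upwards [h_tendsto.eventually_ge_atTop (2 * R), h_tendsto.eventually_ge_atTop (R ^ 3)]
      with k hk hk' t ht
    have h_cube : ‖t‖ ^ 3 ≤ R ^ 3 := by gcongr; exact hR t ht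
    refine (norm_psiFactor_sub_one_le (by linarith [hR t ht]) ?_).trans (by gcongr)
    nlinarith

lemma differentiable_psiNum : Differentiable ℂ psiNum :=
  differentiableOn_univ.1 normalProductOn_psiFactor.differentiableOn_tprod

lemma psiNum_ne_zero (ht : ∀ k : ℕ, t ≠ k + 1) : psiNum t ≠ 0 :=
  normalProductOn_psiFactor.tprod_ne_zero (mem_univ t) fun k => psiFactor_ne_zero (ht k)

lemma psiNum_zero : psiNum 0 = 1 := by simp [psiNum, psiFactor]

lemma hasDerivAt_one_sub_mul_exp (u : ℂ) : HasDerivAt (fun u => (1 - u) * exp (u + u ^ 2 / 2))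
    (-u ^ 2 * exp (u + u ^ 2 / 2)) u := by
  have h_exponent := (hasDerivAt_id u).add ((hasDerivAt_pow 2 u).div_const 2)
  refine (((hasDerivAt_id u).const_sub 1).mul h_exponent.cexp).congr_deriv ?_
  simp only [id_eq, Pi.add_apply]
  push_cast
  ring

lemma logDeriv_psiFactor (ht : t ≠ k + 1) :
    logDeriv (psiFactor k) t = -t ^ 2 / ((k + 1) * (k + 1 - t)) := by
  have hk0 : (k : ℂ) + 1 ≠ 0 := Nat.cast_add_one_ne_zero k
  have h_sub : (k : ℂ) + 1 - t ≠ 0 := sub_ne_zero.2 ht.symm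
  have h : HasDerivAt
      (fun t : ℂ => (1 - t / (k + 1)) * exp (t / (k + 1) + (t / (k + 1)) ^ 2 / 2)) _ t :=
    (hasDerivAt_one_sub_mul_exp _).comp t ((hasDerivAt_id t).div_const ((k : ℂ) + 1))
  unfold psiFactor
  rw [logDeriv_fun_pow h.differentiableAt, logDeriv_apply, h.deriv, one_sub_div hk0]
  push_cast
  field_simp

lemma summable_logDeriv_psiFactor (t : ℂ) :
    Summable fun k : ℕ => -t ^ 2 / (((k : ℂ) + 1) * (k + 1 - t)) := by
  refine Summable.of_norm_bounded_eventually_nat (summable_const_div_succ_sq (2 * ‖t‖ ^ 2)) ?_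
  filter_upwards [tendsto_natCast_atTop_atTop.eventually_ge_atTop (2 * ‖t‖)] with k hk
  have h_half : ((k : ℝ) + 1) / 2 ≤ ‖(k : ℂ) + 1 - t‖ := by
    have h := norm_sub_norm_le ((k : ℂ) + 1) t
    rw [norm_natCast_add_one] at h
    linarith
  rw [norm_div, norm_mul, norm_neg, norm_pow, norm_natCast_add_one]
  calc ‖t‖ ^ 2 / (((k : ℝ) + 1) * ‖(k : ℂ) + 1 - t‖)
      ≤ ‖t‖ ^ 2 / (((k : ℝ) + 1) * (((k : ℝ) + 1) / 2)) := by gcongr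
    _ = 2 * ‖t‖ ^ 2 / ((k : ℝ) + 1) ^ 2 := by field_simp

lemma logDeriv_psiNum (ht : ∀ k : ℕ, t ≠ k + 1) :
    logDeriv psiNum t = ∑' k : ℕ, -t ^ 2 / (((k : ℂ) + 1) * (k + 1 - t)) := by
  have h_factor : ∀ k, logDeriv (psiFactor k) t = -t ^ 2 / (((k : ℂ) + 1) * (k + 1 - t)) :=
    fun k => logDeriv_psiFactor (ht k)
  refine (logDeriv_tprod_eq_tsum isOpen_univ (mem_univ t) (fun k => psiFactor_ne_zero (ht k))
    normalProductOn_psiFactor.differentiableOn ?_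
    normalProductOn_psiFactor.hasProdLocallyUniformlyOn.multipliableLocallyUniformlyOn
    (psiNum_ne_zero ht)).trans (tsum_congr h_factor)
  simpa only [h_factor] using summable_logDeriv_psiFactor t

end PsiNum

section Dilog

variable {x : ℂ}

lemma norm_dilog_term_le (hx : ‖x‖ ≤ 1) (n : ℕ) :
    ‖x ^ (n + 1) / ((n : ℂ) + 1) ^ 2‖ ≤ ‖x‖ / ((n : ℝ) + 1) ^ 2 := by
  rw [norm_div, norm_pow, norm_pow, norm_natCast_add_one]
  gcongr
  exact pow_le_of_le_one (norm_nonneg x) hx n.succ_ne_zero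

lemma hasSum_inv_add_one_sq : HasSum (fun n : ℕ => 1 / ((n : ℝ) + 1) ^ 2) (Real.pi ^ 2 / 6) := by
  simpa using (hasSum_nat_add_iff' 1).2 hasSum_zeta_two

lemma norm_dilog_le (hx : ‖x‖ ≤ 1) : ‖dilog x‖ ≤ Real.pi ^ 2 / 6 * ‖x‖ := by
  refine tsum_of_norm_bounded (hasSum_inv_add_one_sq.mul_right ‖x‖) fun n => ?_
  simpa only [one_div_mul_eq_div] using norm_dilog_term_le hx n

lemma continuousOn_dilog : ContinuousOn dilog (Metric.closedBall 0 1) := by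
  refine continuousOn_tsum (fun n => by fun_prop) hasSum_inv_add_one_sq.summable fun n x hx => ?_
  rw [mem_closedBall_zero_iff] at hx
  exact (norm_dilog_term_le hx n).trans (by gcongr)

lemma dilog_one : dilog 1 = (Real.pi : ℂ) ^ 2 / 6 := by
  simpa [dilog] using (hasSum_ofReal.2 hasSum_inv_add_one_sq).tsum_eq

lemma hasDerivAt_dilog (hx : ‖x‖ < 1) (hx0 : x ≠ 0) :
    HasDerivAt dilog (-log (1 - x) / x) x := by
  obtain ⟨r, hxr, hr⟩ := exists_between hx
  have hr0 : 0 < r := (norm_nonneg x).trans_lt hxr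
  have h_log : HasSum (fun n : ℕ => x ^ n / ((n : ℂ) + 1)) (-log (1 - x) / x) := by
    refine ((hasSum_taylorSeries_neg_log' hx).div_const x).congr_fun fun n => ?_
    rw [pow_succ]
    field_simp
  rw [← h_log.tsum_eq]
  refine hasDerivAt_tsum_of_isPreconnected
    (g := fun (n : ℕ) (x : ℂ) => x ^ (n + 1) / ((n : ℂ) + 1) ^ 2)
    (g' := fun (n : ℕ) (x : ℂ) => x ^ n / ((n : ℂ) + 1))
    (summable_geometric_of_lt_one hr0.le hr) Metric.isOpen_ball
    (convex_ball (0 : ℂ) r).isPreconnected (fun n y _ => ?_) (fun n y hy => ?_)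
    (Metric.mem_ball_self hr0) ?_ (mem_ball_zero_iff.2 hxr)
  · refine ((hasDerivAt_pow (n + 1) y).div_const _).congr_deriv ?_
    have hn : (n : ℂ) + 1 ≠ 0 := Nat.cast_add_one_ne_zero n
    push_cast
    field_simp
  · rw [norm_div, norm_pow, norm_natCast_add_one]
    calc ‖y‖ ^ n / ((n : ℝ) + 1) ≤ r ^ n / 1 := by
          gcongr
          · exact (mem_ball_zero_iff.1 hy).le
          · simp
      _ = r ^ n := div_one _
  · simp

end Dilog

section PsiLower

variable {t : ℂ}

/-- The branch of the logarithm of `psiLower` given by its definition as an exponential. -/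
def logPsiLower (t : ℂ) : ℂ :=
  t * log (1 - cexpTwoPiI (-t)) - 1 / (2 * (Real.pi : ℂ) * I) * dilog (cexpTwoPiI (-t))

lemma norm_cexpTwoPiI_neg_lt_one (ht : t.im < 0) : ‖cexpTwoPiI (-t)‖ < 1 :=
  norm_cexpTwoPiI_lt_one (by simpa using ht)

lemma one_sub_cexpTwoPiI_neg_mem_slitPlane (ht : t.im < 0) :
    1 - cexpTwoPiI (-t) ∈ slitPlane := by
  rw [sub_eq_add_neg]
  exact mem_slitPlane_of_norm_lt_one (by simpa using norm_cexpTwoPiI_neg_lt_one ht)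

lemma hasDerivAt_logPsiLower (ht : t.im < 0) : HasDerivAt logPsiLower
    (t * (2 * Real.pi * I * cexpTwoPiI (-t) / (1 - cexpTwoPiI (-t)))) t := by
  have h_slit := one_sub_cexpTwoPiI_neg_mem_slitPlane ht
  have h_ne := slitPlane_ne_zero h_slit
  have h_exp : HasDerivAt (fun t => cexpTwoPiI (-t)) _ t :=
    (hasDerivAt_cexpTwoPiI (-t)).comp t (hasDerivAt_neg t)
  have h_log := (h_exp.const_sub 1).clog h_slit
  have h_dilog := (hasDerivAt_dilog (norm_cexpTwoPiI_neg_lt_one ht)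
    (cexpTwoPiI_ne_zero (-t))).comp t h_exp
  refine (((hasDerivAt_id t).mul h_log).sub
    (h_dilog.const_mul (1 / (2 * (Real.pi : ℂ) * I)))).congr_deriv ?_
  have hpi : 2 * (Real.pi : ℂ) * I ≠ 0 := two_pi_I_ne_zero
  have hx := cexpTwoPiI_ne_zero (-t)
  simp only [id_eq]
  generalize 2 * (Real.pi : ℂ) * I = c at *
  field_simp
  ring

lemma differentiableOn_psiLower : DifferentiableOn ℂ psiLower {t | t.im < 0} := fun _ ht =>
  (hasDerivAt_logPsiLower ht).cexp.differentiableAt.differentiableWithinAt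

lemma logDeriv_psiLower (ht : t.im < 0) : logDeriv psiLower t =
    t * (2 * Real.pi * I * cexpTwoPiI (-t) / (1 - cexpTwoPiI (-t))) := by
  rw [logDeriv_apply, show deriv psiLower t = _ from (hasDerivAt_logPsiLower ht).cexp.deriv]
  exact mul_div_cancel_left₀ _ (exp_ne_zero _)

lemma psiLower_add_one (ht : t.im < 0) :
    psiLower (t + 1) = psiLower t * (1 - cexpTwoPiI (-t)) := by
  have h_periodic : cexpTwoPiI (-(t + 1)) = cexpTwoPiI (-t) := by
    rw [neg_add, ← sub_eq_add_neg, cexpTwoPiI_sub, cexpTwoPiI_one, div_one]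
  have h_ne := slitPlane_ne_zero (one_sub_cexpTwoPiI_neg_mem_slitPlane ht)
  rw [psiLower, h_periodic, add_one_mul, add_sub_right_comm, exp_add, exp_log h_ne, psiLower]

lemma norm_logPsiLower_le (ht : ‖cexpTwoPiI (-t)‖ ≤ 1 / 2) :
    ‖logPsiLower t‖ ≤ 2 * (‖t‖ + 1) * ‖cexpTwoPiI (-t)‖ := by
  set x := cexpTwoPiI (-t)
  have h_log : ‖log (1 - x)‖ ≤ 3 / 2 * ‖x‖ := by
    simpa [sub_eq_add_neg] using norm_log_one_add_half_le_self (z := -x) (by simpa using ht)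
  have h_coeff : ‖(1 / (2 * (Real.pi : ℂ) * I))‖ = 1 / (2 * Real.pi) := by
    simp [abs_of_pos Real.pi_pos]
  calc ‖t * log (1 - x) - 1 / (2 * (Real.pi : ℂ) * I) * dilog x‖
      ≤ ‖t * log (1 - x)‖ + ‖1 / (2 * (Real.pi : ℂ) * I) * dilog x‖ := norm_sub_le _ _
    _ ≤ ‖t‖ * (3 / 2 * ‖x‖) + 1 / (2 * Real.pi) * (Real.pi ^ 2 / 6 * ‖x‖) := by
        rw [norm_mul, norm_mul, h_coeff]
        gcongr
        exact norm_dilog_le (ht.trans (by norm_num))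
    _ = (3 / 2 * ‖t‖ + Real.pi / 12) * ‖x‖ := by
        field_simp
        ring
    _ ≤ 2 * (‖t‖ + 1) * ‖x‖ := by
        gcongr
        linarith [Real.pi_le_four, norm_nonneg t]

lemma norm_psiLower_sub_one_le (ht : (‖t‖ + 1) * ‖cexpTwoPiI (-t)‖ ≤ 1 / 2) :
    ‖psiLower t - 1‖ ≤ 4 * (‖t‖ + 1) * ‖cexpTwoPiI (-t)‖ := by
  have h_half : ‖cexpTwoPiI (-t)‖ ≤ 1 / 2 :=
    (le_mul_of_one_le_left (norm_nonneg _) (by linarith [norm_nonneg t])).trans ht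
  have h := norm_logPsiLower_le h_half
  exact (norm_exp_sub_one_le (x := logPsiLower t) (by linarith)).trans (by linarith)

lemma tendsto_log_one_sub_mul_log :
    Tendsto (fun w : ℝ => Real.log (1 - w) * Real.log w) (𝓝[>] 0) (𝓝 0) := by
  have h_mul_log : Tendsto (fun w : ℝ => w * Real.log w) (𝓝[>] 0) (𝓝 0) := by
    simpa using (Real.continuous_mul_log.tendsto 0).mono_left (nhdsWithin_le_nhds (s := Ioi 0))
  have h_deriv : HasDerivAt (fun w : ℝ => Real.log (1 - w)) (-1) 0 :=
    (((hasDerivAt_id (0 : ℝ)).const_sub 1).log (by simp)).congr_deriv (by simp)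
  have h_slope := (hasDerivAt_iff_tendsto_slope.1 h_deriv).mono_left
    (nhdsWithin_mono (0 : ℝ) fun w (hw : 0 < w) => hw.ne')
  have h_mul := h_slope.mul h_mul_log
  rw [mul_zero] at h_mul
  refine h_mul.congr' ?_
  filter_upwards [self_mem_nhdsWithin] with w (hw : 0 < w)
  rw [slope_def_field, sub_zero, sub_zero, Real.log_one, sub_zero]
  field_simp

/-- A path in the lower half plane ending at `0`, along which `e(-t) = 1 - w`. -/
def lowerPath (w : ℝ) : ℂ := Real.log (1 - w) / (2 * Real.pi) * I

lemma cexpTwoPiI_neg_lowerPath {w : ℝ} (hw : w < 1) : cexpTwoPiI (-lowerPath w) = 1 - w := by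
  have h : 2 * (Real.pi : ℂ) * I * -lowerPath w = Real.log (1 - w) := by
    have hpi : (Real.pi : ℂ) ≠ 0 := ofReal_ne_zero.2 Real.pi_ne_zero
    rw [lowerPath]
    field_simp
    rw [I_sq]
    ring
  rw [cexpTwoPiI, h, ← ofReal_exp, Real.exp_log (by linarith)]
  push_cast
  rfl

lemma lowerPath_im_neg {w : ℝ} (h0 : 0 < w) (h1 : w < 1) : (lowerPath w).im < 0 := by
  have h_log : Real.log (1 - w) < 0 := Real.log_neg (by linarith) (by linarith)
  have h_eq : lowerPath w = (Real.log (1 - w) / (2 * Real.pi) : ℝ) * I := by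
    rw [lowerPath]; push_cast; rfl
  rw [h_eq, im_ofReal_mul, I_im, mul_one]
  exact div_neg_of_neg_of_pos h_log (by positivity)

lemma tendsto_lowerPath : Tendsto lowerPath (𝓝[>] 0) (𝓝[{t | t.im < 0}] 0) := by
  refine tendsto_nhdsWithin_iff.2 ⟨?_, ?_⟩
  · have h_log : ContinuousAt (fun w : ℝ => Real.log (1 - w)) 0 :=
      ContinuousAt.log (by fun_prop) (by simp)
    have h : ContinuousAt lowerPath 0 := by unfold lowerPath; fun_prop
    simpa [lowerPath] using h.tendsto.mono_left nhdsWithin_le_nhds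
  · filter_upwards [Ioo_mem_nhdsGT one_pos] with w hw using lowerPath_im_neg hw.1 hw.2

lemma tendsto_psiLower_lowerPath :
    Tendsto (fun w => psiLower (lowerPath w)) (𝓝[>] 0) (𝓝 (exp (Real.pi * I / 12))) := by
  have h_unit : ∀ᶠ w : ℝ in 𝓝[>] 0, w ∈ Ioo 0 1 := Ioo_mem_nhdsGT one_pos
  have h_dilog : Tendsto (fun w : ℝ => dilog (1 - w)) (𝓝[>] 0) (𝓝 ((Real.pi : ℂ) ^ 2 / 6)) := by
    rw [← dilog_one]
    refine (continuousOn_dilog 1 (by simp)).tendsto.comp (tendsto_nhdsWithin_iff.2 ⟨?_, ?_⟩)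
    · have h : Continuous fun w : ℝ => (1 : ℂ) - w := by fun_prop
      simpa using (h.tendsto 0).mono_left (nhdsWithin_le_nhds (s := Ioi 0))
    · filter_upwards [h_unit] with w hw
      rw [mem_closedBall_zero_iff, ← ofReal_one, ← ofReal_sub, norm_real, Real.norm_of_nonneg]
      · linarith [hw.1]
      · linarith [hw.2]
  have h_log := (continuous_ofReal.tendsto 0).comp tendsto_log_one_sub_mul_log
  have h_exponent := (h_log.mul_const (I / (2 * Real.pi))).sub
    (h_dilog.const_mul (1 / (2 * (Real.pi : ℂ) * I)))
  have h_value : ((0 : ℝ) : ℂ) * (I / (2 * Real.pi)) -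
      1 / (2 * (Real.pi : ℂ) * I) * ((Real.pi : ℂ) ^ 2 / 6) = Real.pi * I / 12 := by
    have hpi : (Real.pi : ℂ) ≠ 0 := ofReal_ne_zero.2 Real.pi_ne_zero
    field_simp
    rw [I_sq]
    push_cast
    ring
  rw [← h_value]
  refine h_exponent.cexp.congr' ?_
  filter_upwards [h_unit] with w hw
  rw [psiLower, cexpTwoPiI_neg_lowerPath hw.2, sub_sub_cancel, ← ofReal_log hw.1.le, lowerPath,
    Function.comp_apply]
  push_cast
  ring_nf

end PsiLower

section Psi

variable {t : ℂ}

/-- The meromorphic continuation of `psiLower`, with zeros of order `n` at the positive integers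
`n` and poles of order `n` at the negative integers `-n`. -/
def psi (t : ℂ) : ℂ :=
  exp (Real.pi * I / 12 - Real.pi * I * t ^ 2 / 2 + t) * psiNum t / psiNum (-t)

/-- The complement of the nonzero integers, on which `psi` is holomorphic and has no zeros. -/
def psiRegularSet : Set ℂ := {t | ∀ n : ℤ, t = n → n = 0}

lemma neg_mem_psiRegularSet (ht : t ∈ psiRegularSet) : -t ∈ psiRegularSet := fun n hn =>
  neg_eq_zero.1 (ht (-n) (by rw [Int.cast_neg, ← hn, neg_neg]))

lemma integerComplement_subset_psiRegularSet : integerComplement ⊆ psiRegularSet :=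
  fun _ ht n hn => absurd ⟨n, hn.symm⟩ ht

lemma zero_mem_psiRegularSet : 0 ∈ psiRegularSet := fun n hn => by exact_mod_cast hn.symm

lemma mem_integerComplement_of_im_neg (ht : t.im < 0) : t ∈ integerComplement := by
  rintro ⟨n, rfl⟩
  simp at ht

lemma isPreconnected_integerComplement : IsPreconnected integerComplement :=
  ((countable_range _).isConnected_compl_of_one_lt_rank (by simp)).isPreconnected

lemma psiNum_ne_zero_of_mem (ht : t ∈ psiRegularSet) : psiNum t ≠ 0 :=
  psiNum_ne_zero fun k hk => k.cast_add_one_ne_zero (R := ℤ) (ht (k + 1) (by push_cast; exact hk))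

lemma differentiable_psiNum_neg : Differentiable ℂ fun t => psiNum (-t) :=
  differentiable_psiNum.comp differentiable_neg

lemma differentiable_psi_numerator : Differentiable ℂ fun t : ℂ =>
    exp (Real.pi * I / 12 - Real.pi * I * t ^ 2 / 2 + t) * psiNum t :=
  Differentiable.mul (by fun_prop) differentiable_psiNum

lemma differentiableAt_psi (ht : t ∈ psiRegularSet) : DifferentiableAt ℂ psi t :=
  differentiable_psi_numerator.differentiableAt.div differentiable_psiNum_neg.differentiableAt
    (psiNum_ne_zero_of_mem (neg_mem_psiRegularSet ht))

lemma psi_ne_zero (ht : t ∈ psiRegularSet) : psi t ≠ 0 :=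
  div_ne_zero (mul_ne_zero (exp_ne_zero _) (psiNum_ne_zero_of_mem ht))
    (psiNum_ne_zero_of_mem (neg_mem_psiRegularSet ht))

lemma psi_zero : psi 0 = exp (Real.pi * I / 12) := by simp [psi, psiNum_zero]

lemma psi_mul_psi_neg (ht : t ∈ psiRegularSet) :
    psi t * psi (-t) = exp (-(Real.pi * I * (t ^ 2 - 1 / 6))) := by
  have h_pos := psiNum_ne_zero_of_mem ht
  have h_neg := psiNum_ne_zero_of_mem (neg_mem_psiRegularSet ht)
  rw [psi, psi, neg_neg, div_mul_div_comm, mul_mul_mul_comm, mul_comm (psiNum (-t)),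
    mul_div_cancel_right₀ _ (mul_ne_zero h_pos h_neg), ← exp_add]
  ring_nf

lemma logDeriv_psiNum_add_logDeriv_psiNum_neg (ht : t ∈ integerComplement) :
    logDeriv psiNum t + logDeriv psiNum (-t) = t * (Real.pi * cot (Real.pi * t)) - 1 := by
  have h_pos (k : ℕ) : t - (k + 1) ≠ 0 := fun h =>
    ht ⟨k + 1, by push_cast; linear_combination -h⟩
  have h_neg (k : ℕ) : t + (k + 1) ≠ 0 := fun h =>
    ht ⟨-(k + 1), by push_cast; linear_combination -h⟩
  have h_term (k : ℕ) : -t ^ 2 / (((k : ℂ) + 1) * (k + 1 - t)) +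
      -(-t) ^ 2 / ((k + 1) * (k + 1 - -t)) = t * (1 / (t - (k + 1)) + 1 / (t + (k + 1))) := by
    have h0 : (k : ℂ) + 1 ≠ 0 := Nat.cast_add_one_ne_zero k
    have h1 := h_pos k
    have h2 := h_neg k
    rw [← neg_sub t, sub_neg_eq_add, add_comm _ t]
    field_simp
    ring
  rw [logDeriv_psiNum fun k hk => h_pos k (sub_eq_zero.2 hk),
    logDeriv_psiNum fun k hk => h_neg k (by rw [← hk, add_neg_cancel]),
    ← (summable_logDeriv_psiFactor t).tsum_add (summable_logDeriv_psiFactor (-t)),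
    tsum_congr h_term, tsum_mul_left, ← cot_series_rep' ht, mul_sub,
    mul_one_div_cancel (integerComplement.ne_zero ht)]

lemma logDeriv_psi (ht : t ∈ integerComplement) :
    logDeriv psi t = -(Real.pi * I * t) + t * (Real.pi * cot (Real.pi * t)) := by
  have ht' := integerComplement_subset_psiRegularSet ht
  have h_exponent : HasDerivAt
      (fun t : ℂ => Real.pi * I / 12 - Real.pi * I * t ^ 2 / 2 + t) (-(Real.pi * I * t) + 1) t := by
    have h := (((hasDerivAt_pow 2 t).const_mul (Real.pi * I)).div_const 2).const_sub
      (Real.pi * I / 12)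
    refine (h.add (hasDerivAt_id t)).congr_deriv ?_
    push_cast
    ring
  have h_exp : logDeriv (fun t : ℂ => exp (Real.pi * I / 12 - Real.pi * I * t ^ 2 / 2 + t)) t =
      -(Real.pi * I * t) + 1 := by
    rw [logDeriv_apply, h_exponent.cexp.deriv, mul_div_cancel_left₀ _ (exp_ne_zero _)]
  have h_neg : logDeriv (fun t => psiNum (-t)) t = -logDeriv psiNum (-t) := by
    simpa [Function.comp_def] using logDeriv_comp (g := fun t : ℂ => -t) (x := t)
      differentiable_psiNum.differentiableAt (by fun_prop)
  have h_psiNum := psiNum_ne_zero_of_mem ht'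
  have h_num : logDeriv (fun t : ℂ =>
      exp (Real.pi * I / 12 - Real.pi * I * t ^ 2 / 2 + t) * psiNum t) t =
      -(Real.pi * I * t) + 1 + logDeriv psiNum t := by
    rw [← h_exp]
    exact logDeriv_mul t (exp_ne_zero _) h_psiNum h_exponent.cexp.differentiableAt
      differentiable_psiNum.differentiableAt
  have h_div : logDeriv psi t = -(Real.pi * I * t) + 1 + logDeriv psiNum t
      - -logDeriv psiNum (-t) := by
    rw [← h_num, ← h_neg]
    exact logDeriv_div t (mul_ne_zero (exp_ne_zero _) h_psiNum)
      (psiNum_ne_zero_of_mem (neg_mem_psiRegularSet ht'))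
      differentiable_psi_numerator.differentiableAt differentiable_psiNum_neg.differentiableAt
  rw [h_div]
  linear_combination logDeriv_psiNum_add_logDeriv_psiNum_neg ht

lemma logDeriv_psiLower_eq_logDeriv_psi (ht : t.im < 0) : logDeriv psiLower t = logDeriv psi t := by
  have h_ne : 1 - cexpTwoPiI (-t) ≠ 0 :=
    slitPlane_ne_zero (one_sub_cexpTwoPiI_neg_mem_slitPlane ht)
  rw [logDeriv_psiLower ht, logDeriv_psi (mem_integerComplement_of_im_neg ht),
    cot_pi_eq_exp_ratio, show exp (2 * Real.pi * I * t) = cexpTwoPiI t from rfl]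
  rw [cexpTwoPiI_neg] at *
  have hx := cexpTwoPiI_ne_zero t
  generalize cexpTwoPiI t = x at *
  have h_sub : x - 1 ≠ 0 := by
    have h := mul_ne_zero hx h_ne
    rwa [mul_sub, mul_inv_cancel₀ hx, mul_one] at h
  have h_sub' : 1 - x ≠ 0 := by rwa [← neg_ne_zero, neg_sub]
  field_simp
  rw [I_sq]
  ring

lemma eqOn_psi_psiLower : EqOn psi psiLower {t | t.im < 0} := by
  have h_regular {t : ℂ} (ht : t.im < 0) : t ∈ psiRegularSet :=
    integerComplement_subset_psiRegularSet (mem_integerComplement_of_im_neg ht)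
  obtain ⟨c, -, hc⟩ := (logDeriv_eqOn_iff differentiableOn_psiLower
    (fun t ht => (differentiableAt_psi (h_regular ht)).differentiableWithinAt)
    (isOpen_lt continuous_im continuous_const) (convex_halfSpace_im_lt 0).isPreconnected
    (fun t ht => psi_ne_zero (h_regular ht)) fun t _ => exp_ne_zero _).1
    fun t ht => logDeriv_psiLower_eq_logDeriv_psi ht
  have h_psi : Tendsto (c • psi) (𝓝[{t | t.im < 0}] 0) (𝓝 (c * exp (Real.pi * I / 12))) := by
    rw [← psi_zero]
    exact ((differentiableAt_psi zero_mem_psiRegularSet).continuousAt.const_smul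
      c).continuousWithinAt.tendsto
  have h_lim := (h_psi.congr' (eventually_nhdsWithin_of_forall fun t ht => (hc ht).symm)).comp
    tendsto_lowerPath
  have hc_one : c = 1 := mul_right_cancel₀ (exp_ne_zero _)
    ((tendsto_nhds_unique h_lim tendsto_psiLower_lowerPath).trans (one_mul _).symm)
  intro t ht
  rw [hc ht, hc_one, one_smul]

lemma isPsiContinuation_psi : IsPsiContinuation psi := by
  refine ⟨fun t _ => MeromorphicNFOn.div (differentiable_psi_numerator.analyticAt t)
    (differentiable_psiNum_neg.analyticAt t).meromorphicNFAt ?_, eqOn_psi_psiLower⟩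
  by_cases ht : ∃ k : ℕ, t = k + 1
  · obtain ⟨k, rfl⟩ := ht
    refine Or.inl (psiNum_ne_zero fun j hj => ?_)
    have h : (k : ℂ) + 1 + (j + 1) = 0 := by rw [← hj, add_neg_cancel]
    norm_cast at h
  · exact Or.inr (mul_ne_zero (exp_ne_zero _) (psiNum_ne_zero (not_exists.1 ht)))

lemma IsPsiContinuation.unique {φ ψ : ℂ → ℂ} (hφ : IsPsiContinuation φ)
    (hψ : IsPsiContinuation ψ) : φ = ψ := by
  have h_mero : MeromorphicOn (φ - ψ) univ := hφ.1.meromorphicOn.sub hψ.1.meromorphicOn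
  have h_lower : meromorphicOrderAt (φ - ψ) (-I) = ⊤ := by
    rw [meromorphicOrderAt_eq_top_iff]
    refine Eventually.filter_mono nhdsWithin_le_nhds ?_
    filter_upwards [(isOpen_lt continuous_im continuous_const).mem_nhds
      (show (-I).im < 0 by simp)] with t ht
    rw [Pi.sub_apply, hφ.2 ht, hψ.2 ht, sub_self]
  funext t
  have ht : meromorphicOrderAt (φ - ψ) t = ⊤ := by
    by_contra h
    exact h_mero.meromorphicOrderAt_ne_top_of_isPreconnected isPreconnected_univ (mem_univ t)
      (mem_univ (-I)) h h_lower
  rw [meromorphicOrderAt_eq_top_iff] at ht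
  exact (((hφ.1 (mem_univ t)).eventuallyEq_nhdsNE_iff_eventuallyEq_nhds (hψ.1 (mem_univ t))).1
    (ht.mono fun s hs => sub_eq_zero.1 hs)).eq_of_nhds

lemma psi_add_one (ht : t ∈ integerComplement) :
    psi (t + 1) = psi t * (1 - cexpTwoPiI (-t)) := by
  have h_open : IsOpen integerComplement := isOpen_compl_range_intCast
  have h_shift {t : ℂ} (ht : t ∈ integerComplement) : t + 1 ∈ integerComplement := by
    simpa using (add_intCast_mem_integerComplement 1).2 ht
  have h_psi {t : ℂ} (ht : t ∈ integerComplement) : DifferentiableAt ℂ psi t :=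
    differentiableAt_psi (integerComplement_subset_psiRegularSet ht)
  have h_left : DifferentiableOn ℂ (fun t => psi (t + 1)) integerComplement := fun t ht =>
    (differentiableAt_comp_add_const.2 (h_psi (h_shift ht))).differentiableWithinAt
  have h_right : DifferentiableOn ℂ (fun t => psi t * (1 - cexpTwoPiI (-t))) integerComplement :=
    fun t ht => ((h_psi ht).mul ((differentiable_cexpTwoPiI.comp
      differentiable_neg).const_sub 1).differentiableAt).differentiableWithinAt
  refine (h_left.analyticOnNhd h_open).eqOn_of_preconnected_of_eventuallyEq
    (h_right.analyticOnNhd h_open) isPreconnected_integerComplement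
    (mem_integerComplement_of_im_neg (t := -I) (by simp)) ?_ ht
  filter_upwards [(isOpen_lt continuous_im continuous_const).mem_nhds
    (show (-I).im < 0 by simp)] with t ht
  rw [eqOn_psi_psiLower ht, eqOn_psi_psiLower (show (t + 1).im < 0 by simpa using ht),
    psiLower_add_one ht]

end Psi

section PsiProduct

variable {τ z : ℂ}

lemma natCast_add_div_mem_psiRegularSet (hτ : 0 < τ.im)
    (hz : z ∈ ((modularPair hτ).lattice \ {0} : Set ℂ)ᶜ) (k : ℕ) :
    (k + z) / τ ∈ psiRegularSet := by
  intro n hn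
  rw [div_eq_iff (ne_zero_of_im_pos hτ)] at hn
  have hz0 : z = 0 := by
    by_contra h0
    exact hz ⟨(mem_lattice_modularPair hτ).2
      ⟨-k, n, by push_cast; linear_combination hn⟩, h0⟩
  simpa [hz0, hτ.ne', eq_comm] using congrArg im hn

lemma div_mem_integerComplement (hτ : 0 < τ.im) (hz : z ∉ (modularPair hτ).lattice) :
    z / τ ∈ integerComplement := by
  rintro ⟨n, hn⟩
  rw [eq_div_iff (ne_zero_of_im_pos hτ)] at hn
  exact hz ((mem_lattice_modularPair hτ).2 ⟨0, n, by simp [hn]⟩)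

lemma natCast_add_notMem_lattice (hτ : 0 < τ.im) (hz : z ∉ (modularPair hτ).lattice) (k : ℕ) :
    k + z ∉ (modularPair hτ).lattice := by
  rw [add_comm, add_mem_cancel_right]
  · exact hz
  · simpa using nsmul_mem (one_mem_lattice hτ) k

lemma cexpTwoPiI_neg_natCast_add_div (z τ : ℂ) (k : ℕ) :
    cexpTwoPiI (-((k + z) / τ)) = cexpTwoPiI (-(z / τ)) * cexpTwoPiI (-1 / τ) ^ k := by
  rw [← cexpTwoPiI_natCast_mul, ← cexpTwoPiI_add]
  ring_nf

lemma summable_affine_mul_geometric {r : ℝ} (hr : ‖r‖ < 1) (a b : ℝ) :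
    Summable fun k : ℕ => (a * k + b) * r ^ k := by
  simpa only [add_mul, mul_assoc, pow_one] using
    ((summable_pow_mul_geometric_of_norm_lt_one 1 hr).mul_left a).add
      ((summable_geometric_of_norm_lt_one hr).mul_left b)

lemma norm_psi_sub_one_le {t : ℂ} (ht : (‖t‖ + 1) * ‖cexpTwoPiI (-t)‖ ≤ 1 / 2) :
    ‖psi t - 1‖ ≤ 4 * (‖t‖ + 1) * ‖cexpTwoPiI (-t)‖ := by
  have h_le : ‖cexpTwoPiI (-t)‖ ≤ 1 / 2 :=
    (le_mul_of_one_le_left (norm_nonneg _) (by linarith [norm_nonneg t])).trans ht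
  have h_im : t.im < 0 := by
    simpa using norm_cexpTwoPiI_lt_one_iff.1 (h_le.trans_lt one_half_lt_one)
  rw [eqOn_psi_psiLower h_im]
  exact norm_psiLower_sub_one_le ht

lemma normalProductOn_psi (hτ : 0 < τ.im) :
    NormalProductOn (fun (k : ℕ) z => psi ((k + z) / τ))
      ((modularPair hτ).lattice \ {0} : Set ℂ)ᶜ where
  isOpen := (modularPair hτ).isOpen_compl_lattice_sdiff
  differentiableOn k z hz := by
    have h_psi := differentiableAt_psi (natCast_add_div_mem_psiRegularSet hτ hz k)
    have h_arg : DifferentiableAt ℂ (fun z => (k + z) / τ) z := by fun_prop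
    exact (h_psi.comp z h_arg).differentiableWithinAt
  bound K _ hK := by
    obtain ⟨R, hR⟩ := hK.isBounded.exists_norm_le
    set A := Real.exp (2 * Real.pi * (R / ‖τ‖))
    set v : ℕ → ℝ := fun k =>
      (A * ‖τ‖⁻¹ * k + A * (R / ‖τ‖ + 1)) * ‖cexpTwoPiI (-1 / τ)‖ ^ k
    have hv : Summable v := summable_affine_mul_geometric
      (by simpa using norm_cexpTwoPiI_lt_one (im_neg_one_div_pos hτ)) _ _
    have h_bound (k : ℕ) {z : ℂ} (hz : z ∈ K) :
        (‖(k + z) / τ‖ + 1) * ‖cexpTwoPiI (-((k + z) / τ))‖ ≤ v k := by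
      have h_norm : ‖(k + z) / τ‖ ≤ (k + R) / ‖τ‖ := by
        rw [norm_div]
        gcongr
        exact (norm_add_le _ _).trans (by simpa using hR z hz)
      have h_exp : ‖cexpTwoPiI (-(z / τ))‖ ≤ A := by
        refine (norm_cexpTwoPiI_le _).trans (Real.exp_le_exp.2 ?_)
        rw [norm_neg, norm_div]
        gcongr
        exact hR z hz
      rw [cexpTwoPiI_neg_natCast_add_div, norm_mul, norm_pow]
      calc _ ≤ ((k + R) / ‖τ‖ + 1) * (A * ‖cexpTwoPiI (-1 / τ)‖ ^ k) :=
            mul_le_mul (by gcongr) (by gcongr) (by positivity)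
              (by linarith [norm_nonneg ((k + z) / τ)])
        _ = v k := by ring
    refine ⟨fun k => 4 * v k, hv.mul_left 4, ?_⟩
    filter_upwards [hv.tendsto_cofinite_zero.eventually_le_const one_half_pos] with k hk z hz
    refine (norm_psi_sub_one_le ((h_bound k hz).trans hk)).trans ?_
    rw [mul_assoc]
    exact mul_le_mul_of_nonneg_left (h_bound k hz) (by norm_num)

/-- The infinite product of the values of `psi` at `(k + z) / τ`, `k ≥ 0`, for `0 < Im τ`. -/
def psiProd (τ z : ℂ) : ℂ := ∏' k : ℕ, psi ((k + z) / τ)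

lemma psiProd_ne_zero (hτ : 0 < τ.im) (hz : z ∈ ((modularPair hτ).lattice \ {0} : Set ℂ)ᶜ) :
    psiProd τ z ≠ 0 :=
  (normalProductOn_psi hτ).tprod_ne_zero hz fun k =>
    psi_ne_zero (natCast_add_div_mem_psiRegularSet hτ hz k)

lemma psiProd_eq_mul_psiProd_add_one (hτ : 0 < τ.im) (hz : z ∉ (modularPair hτ).lattice) :
    psiProd τ z = psi (z / τ) * psiProd τ (z + 1) := by
  have hz1 : z + 1 ∉ (modularPair hτ).lattice := by rwa [add_mem_cancel_right (one_mem_lattice hτ)]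
  have h_shift (k : ℕ) : ((k + 1 : ℕ) + z) / τ = (k + (z + 1)) / τ := by
    push_cast
    ring
  rw [psiProd, tprod_eq_zero_mul']
  · simp only [h_shift, Nat.cast_zero, zero_add]
    rfl
  · simpa only [h_shift] using (normalProductOn_psi hτ).multipliable fun h => hz1 h.1

lemma psiProd_add_self (hτ : 0 < τ.im) (hz : z ∉ (modularPair hτ).lattice) :
    psiProd τ (z + τ) = psiProd τ z * qProd (cexpTwoPiI (-(z / τ))) (cexpTwoPiI (-1 / τ)) := by
  have h_factor (k : ℕ) : psi ((k + (z + τ)) / τ) =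
      psi ((k + z) / τ) * (1 - cexpTwoPiI (-(z / τ)) * cexpTwoPiI (-1 / τ) ^ k) := by
    rw [← cexpTwoPiI_neg_natCast_add_div, ← add_assoc, add_div _ τ,
      div_self (ne_zero_of_im_pos hτ)]
    exact psi_add_one (div_mem_integerComplement hτ (natCast_add_notMem_lattice hτ hz k))
  rw [psiProd, psiProd, qProd, tprod_congr h_factor]
  exact ((normalProductOn_psi hτ).multipliable fun h => hz h.1).tprod_mul
    (multipliable_qProd (norm_cexpTwoPiI_lt_one (im_neg_one_div_pos hτ)) _)

end PsiProduct

section PsiQuotient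

variable {τ z : ℂ}

/-- The product of the quotients `psi ((k + 1 + z) / τ) / psi ((k - z) / τ)`, `k ≥ 0`, with the
singularity at `z = 0` removed by means of `psiProd τ z = psi (z / τ) * psiProd τ (z + 1)`. -/
def psiQuotient (τ z : ℂ) : ℂ := psiProd τ z / (psi (z / τ) * psiProd τ (-z))

lemma div_mem_psiRegularSet (hτ : 0 < τ.im)
    (hz : z ∈ ((modularPair hτ).lattice \ {0} : Set ℂ)ᶜ) : z / τ ∈ psiRegularSet := by
  simpa using natCast_add_div_mem_psiRegularSet hτ hz 0

lemma psiQuotient_ne_zero (hτ : 0 < τ.im) (hz : z ∈ ((modularPair hτ).lattice \ {0} : Set ℂ)ᶜ) :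
    psiQuotient τ z ≠ 0 :=
  div_ne_zero (psiProd_ne_zero hτ hz) (mul_ne_zero (psi_ne_zero (div_mem_psiRegularSet hτ hz))
    (psiProd_ne_zero hτ (neg_mem_compl_lattice_sdiff hz)))

lemma differentiableOn_psiQuotient (hτ : 0 < τ.im) :
    DifferentiableOn ℂ (psiQuotient τ) ((modularPair hτ).lattice \ {0} : Set ℂ)ᶜ := by
  have h_prod : DifferentiableOn ℂ (psiProd τ) _ := (normalProductOn_psi hτ).differentiableOn_tprod
  refine h_prod.div (.mul (fun z hz => ?_) ?_) fun z hz => ?_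
  · have h_arg : DifferentiableAt ℂ (fun z => z / τ) z := by fun_prop
    exact ((differentiableAt_psi (div_mem_psiRegularSet hτ hz)).comp z
      h_arg).differentiableWithinAt
  · exact h_prod.comp differentiable_neg.differentiableOn fun z => neg_mem_compl_lattice_sdiff
  · exact mul_ne_zero (psi_ne_zero (div_mem_psiRegularSet hτ hz))
      (psiProd_ne_zero hτ (neg_mem_compl_lattice_sdiff hz))

lemma psiQuotient_zero (hτ : 0 < τ.im) : psiQuotient τ 0 = exp (-(Real.pi * I / 12)) := by
  rw [psiQuotient, neg_zero, zero_div, psi_zero, div_mul_cancel_right₀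
    (psiProd_ne_zero hτ (by simp)), exp_neg]

lemma psiQuotient_eq_div (hτ : 0 < τ.im) (hz : z ∉ (modularPair hτ).lattice) :
    psiQuotient τ z = psiProd τ (z + 1) / psiProd τ (-z) := by
  rw [psiQuotient, psiProd_eq_mul_psiProd_add_one hτ hz, mul_div_mul_left _ _
    (psi_ne_zero (div_mem_psiRegularSet hτ (mem_compl_lattice_sdiff hz)))]

lemma hasProd_psiQuotient (hτ : 0 < τ.im) (hz : z ∉ (modularPair hτ).lattice) :
    HasProd (fun k : ℕ => psi ((k + 1 + z) / τ) / psi ((k - z) / τ)) (psiQuotient τ z) := by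
  have h_psi := normalProductOn_psi hτ
  have hz_add : z + 1 ∈ ((modularPair hτ).lattice \ {0} : Set ℂ)ᶜ :=
    mem_compl_lattice_sdiff (by rwa [add_mem_cancel_right (one_mem_lattice hτ)])
  have hz_neg := neg_mem_compl_lattice_sdiff (mem_compl_lattice_sdiff hz)
  have h_add : HasProd _ (psiProd τ (z + 1)) := (h_psi.multipliable hz_add).hasProd
  have h_neg : HasProd _ (psiProd τ (-z)) := (h_psi.multipliable hz_neg).hasProd
  rw [psiQuotient_eq_div hτ hz]
  simpa only [add_assoc, add_comm z, sub_eq_add_neg] using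
    h_add.div₀ h_neg (psiProd_ne_zero hτ hz_neg)

lemma psiQuotient_add_one (hτ : 0 < τ.im) (hz : z ∉ (modularPair hτ).lattice) :
    psiQuotient τ (z + 1) =
      psiQuotient τ z * exp (Real.pi * I * (((z + 1) / τ) ^ 2 - 1 / 6)) := by
  have hz1 : z + 1 ∉ (modularPair hτ).lattice := by rwa [add_mem_cancel_right (one_mem_lattice hτ)]
  have h_neg := psiProd_eq_mul_psiProd_add_one hτ (neg_mem_iff.not.2 hz1)
  rw [neg_add_rev, neg_add_cancel_comm, ← neg_add_rev, neg_div] at h_neg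
  rw [psiQuotient_eq_div hτ hz, psiQuotient, h_neg, ← mul_assoc, psi_mul_psi_neg
    (div_mem_psiRegularSet hτ (mem_compl_lattice_sdiff hz1)), mul_comm (exp _), ← div_div,
    div_eq_mul_inv _ (exp _), ← exp_neg, neg_neg]

lemma psiQuotient_add_self (hτ : 0 < τ.im) (hz : z ∉ (modularPair hτ).lattice) :
    psiQuotient τ (z + τ) = psiQuotient τ z * thetaZero (z / τ) (-1 / τ) := by
  have h_arg : (z + τ) / τ = z / τ + 1 := by rw [add_div, div_self (ne_zero_of_im_pos hτ)]
  have hz_add : -(z + τ) ∉ (modularPair hτ).lattice := by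
    rwa [neg_mem_iff, add_mem_cancel_right (self_mem_lattice hτ)]
  have hz_div := div_notMem_lattice hτ hz
  have h_neg := psiProd_add_self hτ hz_add
  rw [neg_add_rev, neg_add_cancel_comm, ← neg_add_rev, neg_div, neg_neg, h_arg, cexpTwoPiI_add,
    cexpTwoPiI_one, mul_one] at h_neg
  have h_exp : 1 - cexpTwoPiI (-(z / τ)) ≠ 0 := fun h =>
    mul_ne_zero (qProd_cexpTwoPiI_ne_zero _ hz_div)
      (qProd_cexpTwoPiI_ne_zero _ (neg_mem_iff.not.2 hz_div))
      (by rw [qProd_cexpTwoPiI_mul_qProd_cexpTwoPiI_neg (im_neg_one_div_pos hτ), h, zero_mul])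
  have h_psi := psi_ne_zero (div_mem_psiRegularSet hτ (mem_compl_lattice_sdiff hz))
  have h_prod := psiProd_ne_zero hτ (mem_compl_lattice_sdiff hz_add)
  have h_theta := qProd_cexpTwoPiI_mul_qProd_cexpTwoPiI_neg (im_neg_one_div_pos hτ) (z / τ)
  rw [psiQuotient, psiQuotient, psiProd_add_self hτ hz, h_neg, h_arg,
    psi_add_one (div_mem_integerComplement hτ hz), div_mul_eq_mul_div,
    div_eq_div_iff (mul_ne_zero (mul_ne_zero h_psi h_exp) h_prod)
      (mul_ne_zero h_psi (mul_ne_zero h_prod (qProd_cexpTwoPiI_ne_zero _ hz_div)))]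
  linear_combination psiProd τ z * psi (z / τ) * psiProd τ (-(z + τ)) * h_theta

end PsiQuotient

section ThetaRatio

lemma dslope_div_dslope {f g : ℂ → ℂ} {a z : ℂ} (hfa : f a = 0) (hga : g a = 0) (hz : z ≠ a) :
    dslope f a z / dslope g a z = f z / g z := by
  rw [dslope_of_ne _ hz, dslope_of_ne _ hz, slope_def_field, slope_def_field, hfa, hga, sub_zero,
    sub_zero, div_div_div_cancel_right₀ (sub_ne_zero.2 hz)]

lemma differentiableOn_dslope_div_dslope {f g : ℂ → ℂ} {U : Set ℂ} {a : ℂ} (hU : U ∈ 𝓝 a)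
    (hf : DifferentiableOn ℂ f U) (hg : DifferentiableOn ℂ g U) (hga : deriv g a ≠ 0)
    (hne : ∀ z ∈ U, z ≠ a → g z ≠ g a) :
    DifferentiableOn ℂ (fun z => dslope f a z / dslope g a z) U := by
  refine ((differentiableOn_dslope hU).2 hf).div ((differentiableOn_dslope hU).2 hg) fun z hz => ?_
  rcases eq_or_ne z a with rfl | hza
  · rwa [dslope_same]
  · rw [dslope_of_ne _ hza, slope_def_field]
    exact div_ne_zero (sub_ne_zero.2 (hne z hz hza)) (sub_ne_zero.2 hza)

variable {τ z : ℂ}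

/-- The quadratic polynomial `B` in `z` for which the modular transformation of `thetaZero` reads
`θ₀(z / τ, -1 / τ) = exp (π i B) θ₀(z, τ)`. -/
def thetaExponent (τ z : ℂ) : ℂ := z ^ 2 / τ + z / τ - z + τ / 6 + 1 / (6 * τ) - 1 / 2

/-- The right side of the modular transformation of `thetaZero` divided by its left side. -/
def thetaRatio (τ z : ℂ) : ℂ :=
  thetaZero z τ * exp (Real.pi * I * thetaExponent τ z) / thetaZero (z / τ) (-1 / τ)

lemma neg_cexpTwoPiI (w : ℂ) : -cexpTwoPiI w = exp (Real.pi * I + 2 * Real.pi * I * w) := by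
  rw [exp_add, exp_pi_mul_I, neg_one_mul]
  rfl

lemma thetaRatio_add_one (hτ : 0 < τ.im) (z : ℂ) : thetaRatio τ (z + 1) = thetaRatio τ z := by
  have h0 := ne_zero_of_im_pos hτ
  have h_theta : thetaZero (z / τ) (-1 / τ) =
      -cexpTwoPiI (-((z + 1) / τ)) * thetaZero ((z + 1) / τ) (-1 / τ) := by
    rw [← thetaZero_add_self (im_neg_one_div_pos hτ)]
    ring_nf
  have h_exp : exp (Real.pi * I * thetaExponent τ z) =
      -cexpTwoPiI (-((z + 1) / τ)) * exp (Real.pi * I * thetaExponent τ (z + 1)) := by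
    rw [neg_cexpTwoPiI, ← exp_add, thetaExponent, thetaExponent]
    congr 1
    field_simp
    ring
  rw [thetaRatio, thetaRatio, h_theta, thetaZero_add_one, h_exp, mul_left_comm,
    mul_div_mul_left _ _ (neg_ne_zero.2 (cexpTwoPiI_ne_zero _))]

lemma thetaRatio_add_self (hτ : 0 < τ.im) (z : ℂ) : thetaRatio τ (z + τ) = thetaRatio τ z := by
  have h0 := ne_zero_of_im_pos hτ
  have h_exp : -cexpTwoPiI (-z) * exp (Real.pi * I * thetaExponent τ (z + τ)) =
      exp (Real.pi * I * thetaExponent τ z) := by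
    rw [neg_cexpTwoPiI, ← exp_add, ← exp_periodic (Real.pi * I * thetaExponent τ z), thetaExponent,
      thetaExponent]
    congr 1
    field_simp
    ring
  rw [thetaRatio, thetaRatio, thetaZero_add_self hτ, add_div, div_self h0, thetaZero_add_one,
    ← h_exp, mul_right_comm, mul_comm (thetaZero z τ), mul_right_comm]

lemma deriv_thetaZero_div_ne_zero (hτ : 0 < τ.im) :
    deriv (fun z => thetaZero (z / τ) (-1 / τ)) 0 ≠ 0 := by
  have hσ := im_neg_one_div_pos hτ
  have hr := norm_cexpTwoPiI_lt_one hσ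
  have h_deriv : HasDerivAt (fun z => thetaZero (z / τ) (-1 / τ)) _ 0 :=
    (hasDerivAt_thetaZero_zero hσ).comp_of_eq 0 ((hasDerivAt_id 0).div_const τ) (by simp)
  rw [h_deriv.deriv]
  exact mul_ne_zero (mul_ne_zero (neg_ne_zero.2 two_pi_I_ne_zero)
    (pow_ne_zero 2 (qProd_ne_zero_of_norm_lt_one hr hr))) (one_div_ne_zero (ne_zero_of_im_pos hτ))

lemma exists_differentiableOn_eqOn_thetaRatio (hτ : 0 < τ.im) :
    ∃ f : ℂ → ℂ, DifferentiableOn ℂ f ((modularPair hτ).lattice \ {0} : Set ℂ)ᶜ ∧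
      EqOn f (thetaRatio τ) {0}ᶜ := by
  have hσ := im_neg_one_div_pos hτ
  have h_num : Differentiable ℂ fun z => thetaZero z τ * exp (Real.pi * I * thetaExponent τ z) := by
    refine (differentiable_thetaZero hτ).mul ?_
    unfold thetaExponent
    fun_prop
  have h_den : Differentiable ℂ fun z => thetaZero (z / τ) (-1 / τ) :=
    (differentiable_thetaZero hσ).comp (by fun_prop)
  have h_den_zero : thetaZero (0 / τ) (-1 / τ) = 0 := by rw [zero_div, thetaZero_zero hσ]
  refine ⟨_, differentiableOn_dslope_div_dslope
    ((modularPair hτ).isOpen_compl_lattice_sdiff.mem_nhds (by simp)) h_num.differentiableOn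
    h_den.differentiableOn (deriv_thetaZero_div_ne_zero hτ) fun z hz hz0 => ?_, fun z hz =>
    dslope_div_dslope (by simp [thetaZero_zero hτ]) h_den_zero hz⟩
  rw [h_den_zero]
  exact thetaZero_ne_zero hσ (div_notMem_lattice hτ fun h => hz ⟨h, hz0⟩)

lemma exists_thetaRatio_eq_const (hτ : 0 < τ.im) :
    ∃ c : ℂ, ∀ z ∉ (modularPair hτ).lattice, thetaRatio τ z = c := by
  obtain ⟨f, hf, h_eq⟩ := exists_differentiableOn_eqOn_thetaRatio hτ
  have h_ratio {z : ℂ} (hz : z ∉ (modularPair hτ).lattice) : f z = thetaRatio τ z :=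
    h_eq fun h => hz (h ▸ zero_mem _)
  refine ⟨f 0, fun z hz => (h_ratio hz).symm.trans
    (eqOn_const_of_norm_periodic hf (fun w hw => ?_) (fun w hw => ?_) (mem_compl_lattice_sdiff hz))⟩
  · rw [h_ratio hw, h_ratio (by rwa [add_mem_cancel_right (PeriodPair.ω₁_mem_lattice _)])]
    exact congrArg _ (thetaRatio_add_one hτ w)
  · rw [h_ratio hw, h_ratio (by rwa [add_mem_cancel_right (PeriodPair.ω₂_mem_lattice _)])]
    exact congrArg _ (thetaRatio_add_self hτ w)

lemma thetaRatio_half_periods (hτ : 0 < τ.im) :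
    thetaRatio τ (1 / 2) * thetaRatio τ (τ / 2) * thetaRatio τ ((1 + τ) / 2) = 1 := by
  have h0 := ne_zero_of_im_pos hτ
  have h_exp : exp (Real.pi * I * thetaExponent τ (1 / 2)) *
      exp (Real.pi * I * thetaExponent τ (τ / 2)) *
      exp (Real.pi * I * thetaExponent τ ((1 + τ) / 2)) = -cexpTwoPiI (1 / τ) := by
    rw [neg_cexpTwoPiI, ← exp_add, ← exp_add,
      ← exp_periodic (Real.pi * I * thetaExponent τ (1 / 2) + _ + _)]
    simp only [thetaExponent]
    congr 1
    field_simp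
    ring
  have h_den := thetaZero_neg_half_periods (im_neg_one_div_pos hτ)
  rw [show -(-1 / τ) / 2 = 1 / 2 / τ by ring, show (1 - -1 / τ) / 2 = (1 + τ) / 2 / τ by
    field_simp; ring, show -(-1 / τ) = 1 / τ by ring, mul_comm (thetaZero (1 / 2) _)] at h_den
  rw [thetaRatio, thetaRatio, thetaRatio, show τ / 2 / τ = 1 / 2 by field_simp, div_mul_div_comm,
    div_mul_div_comm, h_den, mul_mul_mul_comm (thetaZero _ _) (exp _) (thetaZero _ _),
    mul_mul_mul_comm, thetaZero_half_periods hτ, h_exp, mul_neg, neg_mul,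
    div_self (neg_ne_zero.2 (mul_ne_zero two_ne_zero (cexpTwoPiI_ne_zero _)))]

lemma one_add_self_div_two_notMem_lattice (hτ : 0 < τ.im) :
    (1 + τ) / 2 ∉ (modularPair hτ).lattice := by
  have h := (modularPair hτ).mul_ω₁_add_mul_ω₂_mem_lattice (α := 1 / 2) (β := 1 / 2)
  rw [add_div, div_eq_inv_mul, div_eq_inv_mul]
  simpa [modularPair] using h.not.2 (by norm_num)

lemma norm_thetaRatio (hτ : 0 < τ.im) (hz : z ∉ (modularPair hτ).lattice) :
    ‖thetaRatio τ z‖ = 1 := by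
  obtain ⟨c, hc⟩ := exists_thetaRatio_eq_const hτ
  have h := thetaRatio_half_periods hτ
  rw [hc (1 / 2) (modularPair hτ).ω₁_div_two_notMem_lattice,
    hc (τ / 2) (modularPair hτ).ω₂_div_two_notMem_lattice,
    hc _ (one_add_self_div_two_notMem_lattice hτ), ← sq, ← pow_succ] at h
  rw [hc z hz]
  exact norm_eq_one_of_pow_eq_one h (by norm_num)

end ThetaRatio

section GammaRatio

variable {τ z : ℂ}

/-- The quotient of the two sides of the product formula for the elliptic gamma function at the
argument `z + τ`, where the formula has no singularity at `z = 0`. -/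
def gammaRatio (τ z : ℂ) : ℂ :=
  ellipticGamma (z + τ) τ τ * exp (Real.pi * I * cubicQ (z + τ) τ τ) / psiQuotient τ z

lemma gammaRatio_add_one (hτ : 0 < τ.im) (hz : z ∉ (modularPair hτ).lattice) :
    gammaRatio τ (z + 1) = gammaRatio τ z := by
  have h0 := ne_zero_of_im_pos hτ
  have h_exp : exp (Real.pi * I * cubicQ (z + τ + 1) τ τ) =
      exp (Real.pi * I * cubicQ (z + τ) τ τ) *
        exp (Real.pi * I * (((z + 1) / τ) ^ 2 - 1 / 6)) := by
    rw [← exp_add, cubicQ, cubicQ]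
    congr 1
    field_simp
    ring
  rw [gammaRatio, gammaRatio, psiQuotient_add_one hτ hz, add_right_comm, ellipticGamma_add_one,
    h_exp, ← mul_assoc, mul_div_mul_right _ _ (exp_ne_zero _)]

lemma gammaRatio_add_self (hτ : 0 < τ.im) (hz : z ∉ (modularPair hτ).lattice) :
    gammaRatio τ (z + τ) = thetaRatio τ z * gammaRatio τ z := by
  have h0 := ne_zero_of_im_pos hτ
  have hz_add : z + τ ∉ (modularPair hτ).lattice := by
    rwa [add_mem_cancel_right (self_mem_lattice hτ)]
  have h_exp : -cexpTwoPiI (-z) * exp (Real.pi * I * cubicQ (z + τ + τ) τ τ) =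
      exp (Real.pi * I * thetaExponent τ z) * exp (Real.pi * I * cubicQ (z + τ) τ τ) := by
    rw [neg_cexpTwoPiI, ← exp_add, ← exp_add,
      ← exp_periodic (Real.pi * I * thetaExponent τ z + _), cubicQ, cubicQ, thetaExponent]
    congr 1
    field_simp
    ring
  rw [gammaRatio, gammaRatio, psiQuotient_add_self hτ hz, ellipticGamma_add_self hτ hτ hz_add,
    thetaZero_add_self hτ, thetaRatio, div_mul_div_comm, mul_comm (thetaZero (z / τ) _)]
  congr 1
  linear_combination thetaZero z τ * ellipticGamma (z + τ) τ τ * h_exp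

lemma qrProd_cexpTwoPiI_add_self_ne_zero (hτ : 0 < τ.im)
    (hz : z ∈ ((modularPair hτ).lattice \ {0} : Set ℂ)ᶜ) :
    qrProd (cexpTwoPiI (z + τ)) (cexpTwoPiI τ) (cexpTwoPiI τ) ≠ 0 := by
  have hq := norm_cexpTwoPiI_lt_one hτ
  refine qrProd_ne_zero hq hq fun j k h => ?_
  rw [mul_assoc, ← pow_add, ← cexpTwoPiI_natCast_mul, ← cexpTwoPiI_add, cexpTwoPiI_eq_one_iff] at h
  obtain ⟨n, hn⟩ := h
  have hz0 : z = 0 := by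
    by_contra h0
    refine hz ⟨(mem_lattice_modularPair hτ).2 ⟨n, -(j + k + 1), ?_⟩, h0⟩
    push_cast at hn ⊢
    linear_combination hn
  have h_im := congrArg im hn
  simp only [hz0, zero_add, add_im, mul_im, natCast_re, natCast_im, zero_mul, add_zero,
    intCast_im] at h_im
  have : 0 < τ.im + (j + k : ℕ) * τ.im := by positivity
  exact this.ne' h_im

lemma gammaRatio_zero (hτ : 0 < τ.im) : gammaRatio τ 0 = 1 := by
  have h0 := ne_zero_of_im_pos hτ
  have h_gamma : ellipticGamma τ τ τ = 1 := by
    rw [ellipticGamma, mul_div_cancel_right₀ _ (cexpTwoPiI_ne_zero τ)]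
    exact div_self (by simpa using qrProd_cexpTwoPiI_add_self_ne_zero hτ (z := 0) (by simp))
  have h_cubic : cubicQ τ τ τ = -1 / 12 := by
    rw [cubicQ]
    field_simp
    ring
  rw [gammaRatio, psiQuotient_zero hτ, zero_add, h_gamma, one_mul, ← exp_sub, h_cubic,
    show Real.pi * I * (-1 / 12) - -(Real.pi * I / 12) = 0 by ring, exp_zero]

lemma ellipticGamma_add_self_eq_div (τ z : ℂ) : ellipticGamma (z + τ) τ τ =
    qrProd (cexpTwoPiI (τ - z)) (cexpTwoPiI τ) (cexpTwoPiI τ) /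
      qrProd (cexpTwoPiI (z + τ)) (cexpTwoPiI τ) (cexpTwoPiI τ) := by
  rw [ellipticGamma, ← cexpTwoPiI_add, ← cexpTwoPiI_sub, add_sub_add_right_eq_sub]

lemma differentiableOn_gammaRatio (hτ : 0 < τ.im) :
    DifferentiableOn ℂ (gammaRatio τ) ((modularPair hτ).lattice \ {0} : Set ℂ)ᶜ := by
  have hq := norm_cexpTwoPiI_lt_one hτ
  have h_prod {g : ℂ → ℂ} (hg : Differentiable ℂ g) :
      Differentiable ℂ fun z => qrProd (cexpTwoPiI (g z)) (cexpTwoPiI τ) (cexpTwoPiI τ) :=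
    (differentiable_qrProd hq hq).comp (differentiable_cexpTwoPiI.comp hg)
  have h_exp : Differentiable ℂ fun z => exp (Real.pi * I * cubicQ (z + τ) τ τ) := by
    unfold cubicQ
    fun_prop
  have h_gamma : DifferentiableOn ℂ (fun z => ellipticGamma (z + τ) τ τ)
      ((modularPair hτ).lattice \ {0} : Set ℂ)ᶜ := by
    simp only [ellipticGamma_add_self_eq_div]
    exact (h_prod (by fun_prop)).differentiableOn.div (h_prod (by fun_prop)).differentiableOn
      fun z => qrProd_cexpTwoPiI_add_self_ne_zero hτ
  exact (h_gamma.mul h_exp.differentiableOn).div (differentiableOn_psiQuotient hτ)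
    fun z => psiQuotient_ne_zero hτ

lemma gammaRatio_eq_one (hτ : 0 < τ.im) (hz : z ∉ (modularPair hτ).lattice) :
    gammaRatio τ z = 1 := by
  refine (eqOn_const_of_norm_periodic (differentiableOn_gammaRatio hτ) (fun w hw => ?_)
    (fun w hw => ?_) (mem_compl_lattice_sdiff hz)).trans (gammaRatio_zero hτ)
  · exact congrArg _ (gammaRatio_add_one hτ hw)
  · refine (congrArg _ (gammaRatio_add_self hτ hw)).trans ?_
    rw [norm_mul, norm_thetaRatio hτ hw, one_mul]

lemma ellipticGamma_eq_mul_psiQuotient (hτ : 0 < τ.im) (hz : z ∉ (modularPair hτ).lattice) :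
    ellipticGamma z τ τ = exp (-(Real.pi * I * cubicQ z τ τ)) / thetaZero (z / τ) (-1 / τ) *
      psiQuotient τ z := by
  obtain ⟨w, rfl⟩ : ∃ w, z = w + τ := ⟨z - τ, (sub_add_cancel z τ).symm⟩
  have hw : w ∉ (modularPair hτ).lattice := by
    rwa [add_mem_cancel_right (self_mem_lattice hτ)] at hz
  have h_ratio := gammaRatio_eq_one hτ hw
  rw [gammaRatio, div_eq_one_iff_eq (psiQuotient_ne_zero hτ (mem_compl_lattice_sdiff hw))]
    at h_ratio
  have h_theta := thetaZero_ne_zero _ (div_notMem_lattice hτ hw)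
  rw [psiQuotient_add_self hτ hw, ← h_ratio, add_div, div_self (ne_zero_of_im_pos hτ),
    thetaZero_add_one, div_mul_eq_mul_div, eq_div_iff h_theta, exp_neg]
  field_simp [exp_ne_zero (Real.pi * I * cubicQ (w + τ) τ τ)]

end GammaRatio

end

theorem mainTheorem6 :
    ∃ ψ : ℂ → ℂ,
      IsPsiContinuation ψ ∧ (∀ φ : ℂ → ℂ, IsPsiContinuation φ → φ = ψ) ∧
      ∀ τ z : ℂ, 0 < τ.im → (∀ m n : ℤ, z ≠ (m : ℂ) + (n : ℂ) * τ) →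
        Multipliable (fun k : ℕ => ψ (((k : ℂ) + 1 + z) / τ) / ψ (((k : ℂ) - z) / τ)) ∧
        ellipticGamma z τ τ =
          Complex.exp (-((Real.pi : ℂ) * Complex.I * cubicQ z τ τ)) / thetaZero (z / τ) (-1 / τ) *
            ∏' k : ℕ, (ψ (((k : ℂ) + 1 + z) / τ) / ψ (((k : ℂ) - z) / τ)) := by
  refine ⟨psi, isPsiContinuation_psi, fun φ hφ => hφ.unique isPsiContinuation_psi,
    fun τ z hτ hz => ?_⟩
  have hz' : z ∉ (modularPair hτ).lattice := by
    rw [mem_lattice_modularPair]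
    rintro ⟨m, n, h⟩
    exact hz m n h
  have h := hasProd_psiQuotient hτ hz'
  refine ⟨h.multipliable, ?_⟩
  rw [h.tprod_eq]
  exact ellipticGamma_eq_mul_psiQuotient hτ hz'
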